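/- Let $\mathbf F$ be a finite field of characteristic $\ell$, let $p\neq\ell$ be a prime and let $q=p^j$ with $j\ge 1$. Let $\overline G_q=\hat{\mathbf Z}'\rtimes\hat{\mathbf Z}$, where $\hat{\mathbf Z}'$ is the prime-to-$p$ completion of $\mathbf Z$, and let $s$ and $t$ be the topological generators $1$ of $\hat{\mathbf Z}$ and $\hat{\mathbf Z}'$; the semidirect product is formed so that $sts^{-1}=t^q$. Let $\chi:\overline G_q\to\mathbf F_\ell^*$ be the cyclotomic character, $\chi(s)=q$, $\chi(t)=1$, and write $M(1)$ for the twist by $\chi$ of an $\mathbf F[\overline G_q]$-module $M$ (with $\mathbf F$ itself carrying the trivial action). Cohomology is continuous, with discrete coefficients, and is computed by inhomogeneous cochains; 2-cocycles $[\cdot,\cdot]$ satisfy $f[g,h]-[fg,h]+[f,gh]-[f,g]=0$ and are called normalized if $[1,g]=[g,1]=0$ for all $g$. (a) Every class in $H^2(\overline G_q,\mathbf F(1))$ is represented by a normalized 2-cocycle, and there is an $\mathbf F$-linear isomorphism $e:H^2(\overline G_q,\mathbf F(1))\to\mathbf F$ which on the class of every normalized 2-cocycle $[\cdot,\cdot]$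 is given by $$[\cdot,\cdot]\mapsto\sum_{i=1}^{q^{\ell-1}-1}[t^i,t]+[t^{q^{\ell-1}},s^{\ell-1}]-[s^{\ell-1},t].$$ (b) Let $\bar\rho:\overline G_q\to\mathrm{GL}_n(\mathbf F)$ be continuous and unramified, i.e. $\bar\rho(t)=1$, and let $\mathrm{ad}^0(\bar\rho)$ be the space of traceless $n\times n$ matrices with the conjugation action. Let $c_1,c_2$ be continuous 1-cocycles of $\overline G_q$ with values in $\mathrm{ad}^0(\bar\rho)$ and $\mathrm{ad}^0(\bar\rho)(1)$. Consider the pairing $H^1(\overline G_q,\mathrm{ad}^0(\bar\rho))\times H^1(\overline G_q,\mathrm{ad}^0(\bar\rho)(1))\to H^2(\overline G_q,\mathbf F(1))\xrightarrow{e}\mathbf F$ given by the cup product and the form $(A,B)\mapsto\mathrm{Trace}(AB)$. The image of $(c_1,c_2)$ under it is $$\mathrm{Trace}\big(c_1(s)c_2(t)-c_2(s)c_1(t)\big),$$ unless $\ell=2$ and $q\equiv 3\pmod 4$, in which case it is $$\mathrm{Trace}\big(c_1(s)c_2(t)+c_2(s)c_1(t)+c_1(t)c_2(t)\big).$$ (c)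 Let $G$ be any profinite group with a continuous surjection $\pi:G\to\overline G_q$ whose kernel is a pro-$p$ group (for instance the absolute Galois group $G_v$ of a local field with residue field of order $q$ and residue characteristic $p$, with $\pi$ the projection to its tame quotient), and let it act on all modules above through $\pi$. There is an $\mathbf F$-linear isomorphism $e_G:H^2(G,\mathbf F(1))\to\mathbf F$ whose composition with inflation along $\pi$ is $e$. For $\bar\rho$ as in (b), inflation is bijective on $H^1(\cdot,\mathrm{ad}^0(\bar\rho))$ and on $H^1(\cdot,\mathrm{ad}^0(\bar\rho)(1))$. It carries the pairing of (b) to the analogous pairing $H^1(G,\mathrm{ad}^0(\bar\rho))\times H^1(G,\mathrm{ad}^0(\bar\rho)(1))\to H^2(G,\mathbf F(1))\xrightarrow{e_G}\mathbf F$, so the formulas of (b) compute the latter as well. -/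

import Mathlib

noncomputable section

namespace TameDuality

/-! ### Continuous cohomology in degrees one and two, by inhomogeneous cochains

Coefficient modules are discrete, so a cochain is continuous exactly when it is locally constant. -/

section Cohomology

variable {k : Type*} [Field k] {G : Type*} [Group G] [TopologicalSpace G]
  {M : Type*} [AddCommGroup M] [Module k M]

/-- The action of `G` on the discrete module `M` is continuous. -/
def IsDiscreteRep (ρ : Representation k G M) : Prop :=
  ∀ m : M, IsLocallyConstant fun g => ρ g m

/-- Continuous 1-cocycles: `c (g h) = c g + g • c h`. -/
def Z1 (ρ : Representation k G M) : Submodule k (G → M) where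
  carrier := {c | IsLocallyConstant c ∧ ∀ g h, c (g * h) = c g + ρ g (c h)}
  zero_mem' := ⟨IsLocallyConstant.const 0, by simp⟩
  add_mem' := by
    rintro a b ⟨ha, ha'⟩ ⟨hb, hb'⟩
    refine ⟨ha.add hb, fun g h => ?_⟩
    simp only [Pi.add_apply, ha', hb', map_add]
    abel
  smul_mem' := by
    rintro r a ⟨ha, ha'⟩
    refine ⟨ha.comp (r • ·), fun g h => ?_⟩
    simp only [Pi.smul_apply, ha', map_smul, smul_add]

/-- 1-coboundaries `g ↦ g • a - a`. -/
def B1 (ρ : Representation k G M) : Submodule k (G → M) where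
  carrier := {c | ∃ a : M, ∀ g, c g = ρ g a - a}
  zero_mem' := ⟨0, by simp⟩
  add_mem' := by
    rintro a b ⟨x, hx⟩ ⟨y, hy⟩
    refine ⟨x + y, fun g => ?_⟩
    simp only [Pi.add_apply, hx, hy, map_add]
    abel
  smul_mem' := by
    rintro r a ⟨x, hx⟩
    refine ⟨r • x, fun g => ?_⟩
    simp only [Pi.smul_apply, hx, map_smul, smul_sub]

/-- Continuous cohomology `H¹(G, M)`. -/
abbrev H1 (ρ : Representation k G M) : Type _ := Z1 ρ ⧸ (B1 ρ).submoduleOf (Z1 ρ)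

/-- The class of a 1-cocycle. -/
def cls1 {ρ : Representation k G M} (c : Z1 ρ) : H1 ρ :=
  ((B1 ρ).submoduleOf (Z1 ρ)).mkQ c

/-- Continuous 2-cocycles: `f • c (g, h) - c (f g, h) + c (f, g h) - c (f, g) = 0`. -/
def Z2 (ρ : Representation k G M) : Submodule k (G × G → M) where
  carrier := {c | IsLocallyConstant c ∧
    ∀ f g h, ρ f (c (g, h)) - c (f * g, h) + c (f, g * h) - c (f, g) = 0}
  zero_mem' := ⟨IsLocallyConstant.const 0, by simp⟩
  add_mem' := by
    rintro a b ⟨ha, ha'⟩ ⟨hb, hb'⟩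
    refine ⟨ha.add hb, fun f g h => ?_⟩
    have := congrArg₂ (· + ·) (ha' f g h) (hb' f g h)
    simp only [add_zero] at this
    rw [← this]
    simp only [Pi.add_apply, map_add]
    abel
  smul_mem' := by
    rintro r a ⟨ha, ha'⟩
    refine ⟨ha.comp (r • ·), fun f g h => ?_⟩
    have := congrArg (r • ·) (ha' f g h)
    simp only [smul_zero] at this
    rw [← this]
    simp only [Pi.smul_apply, map_smul, smul_sub, smul_add]

/-- Coboundaries of continuous 1-cochains: `(f, g) ↦ f • b g - b (f g) + b f`. -/
def B2 (ρ : Representation k G M) : Submodule k (G × G → M) where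
  carrier := {c | ∃ b : G → M, IsLocallyConstant b ∧
    ∀ f g, c (f, g) = ρ f (b g) - b (f * g) + b f}
  zero_mem' := ⟨0, IsLocallyConstant.const 0, by simp⟩
  add_mem' := by
    rintro a b ⟨x, hxc, hx⟩ ⟨y, hyc, hy⟩
    refine ⟨x + y, hxc.add hyc, fun f g => ?_⟩
    simp only [Pi.add_apply, hx, hy, map_add]
    abel
  smul_mem' := by
    rintro r a ⟨x, hxc, hx⟩
    refine ⟨r • x, hxc.comp (r • ·), fun f g => ?_⟩
    simp only [Pi.smul_apply, hx, map_smul, smul_sub, smul_add]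

/-- Continuous cohomology `H²(G, M)`. -/
abbrev H2 (ρ : Representation k G M) : Type _ := Z2 ρ ⧸ (B2 ρ).submoduleOf (Z2 ρ)

/-- The class of a 2-cocycle. -/
def cls2 {ρ : Representation k G M} (c : Z2 ρ) : H2 ρ :=
  ((B2 ρ).submoduleOf (Z2 ρ)).mkQ c

/-- A 2-cochain is normalized if it vanishes as soon as one argument is `1`. -/
def IsNormalized (c : G × G → M) : Prop := ∀ g, c (1, g) = 0 ∧ c (g, 1) = 0

variable {G' : Type*} [Group G'] [TopologicalSpace G']

/-- The pullback of 1-cocycles along a continuous homomorphism. -/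
def inflZ1 {ρ : Representation k G M} {ρ' : Representation k G' M} (π : G' →ₜ* G)
    (h : ∀ g, ρ' g = ρ (π g)) : Z1 ρ →ₗ[k] Z1 ρ' where
  toFun c := ⟨fun g => c.1 (π g), c.2.1.comp_continuous π.continuous_toFun,
    fun f g => by
      change c.1 (π (f * g)) = c.1 (π f) + ρ' f (c.1 (π g))
      rw [map_mul, c.2.2, h]⟩
  map_add' _ _ := rfl
  map_smul' _ _ := rfl

/-- The pullback of 2-cocycles along a continuous homomorphism. -/
def inflZ2 {ρ : Representation k G M} {ρ' : Representation k G' M} (π : G' →ₜ* G)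
    (h : ∀ g, ρ' g = ρ (π g)) : Z2 ρ →ₗ[k] Z2 ρ' where
  toFun c := ⟨fun x => c.1 (π x.1, π x.2),
    c.2.1.comp_continuous (f := fun x : G' × G' => (π x.1, π x.2))
      ((π.continuous_toFun.comp continuous_fst).prodMk (π.continuous_toFun.comp continuous_snd)),
    fun f g h' => by
      have := c.2.2 (π f) (π g) (π h')
      simpa only [map_mul, h] using this⟩
  map_add' _ _ := rfl
  map_smul' _ _ := rfl

/-- Inflation `H¹(G, M) → H¹(G', M)`. -/
def inflH1 (ρ : Representation k G M) (ρ' : Representation k G' M) (π : G' →ₜ* G)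
    (h : ∀ g, ρ' g = ρ (π g)) : H1 ρ →ₗ[k] H1 ρ' :=
  Submodule.mapQ _ _ (inflZ1 π h) (by
    rintro c ⟨a, ha⟩
    exact ⟨a, fun g => by rw [h]; exact ha (π g)⟩)

/-- Inflation `H²(G, M) → H²(G', M)`. -/
def inflH2 (ρ : Representation k G M) (ρ' : Representation k G' M) (π : G' →ₜ* G)
    (h : ∀ g, ρ' g = ρ (π g)) : H2 ρ →ₗ[k] H2 ρ' :=
  Submodule.mapQ _ _ (inflZ2 π h) (by
    rintro c ⟨b, hb, hbc⟩
    refine ⟨fun g => b (π g), hb.comp_continuous π.continuous_toFun, fun f g => ?_⟩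
    change c.1 (π f, π g) = ρ' f (b (π g)) - b (π (f * g)) + b (π f)
    rw [h, map_mul]
    exact hbc (π f) (π g))

variable {N P : Type*} [AddCommGroup N] [Module k N] [AddCommGroup P] [Module k P]

theorem IsDiscreteRep.locallyConstant {X : Type*} [TopologicalSpace X]
    {ρ : Representation k G M} (hρ : IsDiscreteRep ρ) {u : X → G} (hu : Continuous u)
    {v : X → M} (hv : IsLocallyConstant v) : IsLocallyConstant fun x => ρ (u x) (v x) := by
  rw [IsLocallyConstant.iff_eventually_eq]
  intro x
  have h1 := hv.eventually_eq x
  have h2 := ((hρ (v x)).comp_continuous hu).eventually_eq x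
  filter_upwards [h1, h2] with y hy1 hy2
  rw [hy1]
  exact hy2

/-- The cup product on cocycles, followed by an equivariant bilinear map `β`:
`(f, g) ↦ β (c₁ f) (f • c₂ g)`. -/
def cupZ {ρM : Representation k G M} {ρN : Representation k G N} {ρP : Representation k G P}
    (β : M →ₗ[k] N →ₗ[k] P) (hβ : ∀ g m n, β (ρM g m) (ρN g n) = ρP g (β m n))
    (hN : IsDiscreteRep ρN) : Z1 ρM →ₗ[k] Z1 ρN →ₗ[k] Z2 ρP :=
  LinearMap.mk₂ k
    (fun c₁ c₂ => ⟨fun x => β (c₁.1 x.1) (ρN x.1 (c₂.1 x.2)),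
      (c₁.2.1.comp_continuous continuous_fst).comp₂
        (hN.locallyConstant continuous_fst (c₂.2.1.comp_continuous continuous_snd))
        (fun m n => β m n),
      fun f g h => by
        simp only [← hβ, c₁.2.2, c₂.2.2, map_add, map_mul, Module.End.mul_apply,
          LinearMap.add_apply]
        abel⟩)
    (fun a b c => by ext x; simp)
    (fun r a c => by ext x; simp)
    (fun a b c => by ext x; simp)
    (fun r a c => by ext x; simp)

/-- The cup product `H¹(G, M) × H¹(G, N) → H²(G, P)` induced by an equivariant bilinear map
`β : M × N → P`. -/
def cupH {ρM : Representation k G M} {ρN : Representation k G N} {ρP : Representation k G P}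
    (β : M →ₗ[k] N →ₗ[k] P) (hβ : ∀ g m n, β (ρM g m) (ρN g n) = ρP g (β m n))
    (hN : IsDiscreteRep ρN) : H1 ρM →ₗ[k] H1 ρN →ₗ[k] H2 ρP :=
  Submodule.liftQ _
    (LinearMap.flip (Submodule.liftQ _
      (LinearMap.flip ((cupZ β hβ hN).compr₂ ((B2 ρP).submoduleOf (Z2 ρP)).mkQ)) (by
        rintro c₂ ⟨a, ha⟩
        rw [LinearMap.mem_ker]
        ext c₁
        simp only [LinearMap.flip_apply, LinearMap.compr₂_apply, LinearMap.zero_apply]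
        rw [Submodule.mkQ_apply, Submodule.Quotient.mk_eq_zero]
        refine ⟨fun g => -β (c₁.1 g) (ρN g a),
          (c₁.2.1.comp₂ (hN a) (fun m n => -β m n)), fun f g => ?_⟩
        have ha' : c₂.1 g = ρN g a - a := ha g
        change β (c₁.1 f) (ρN f (c₂.1 g)) = _
        simp only [ha', ← hβ, c₁.2.2, map_add, map_sub, map_neg, map_mul, Module.End.mul_apply,
          LinearMap.add_apply]
        abel)))
    (by
      rintro c₁ ⟨a, ha⟩
      rw [LinearMap.mem_ker]
      ext c₂
      simp only [LinearMap.coe_comp, Function.comp_apply, LinearMap.zero_apply,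
        LinearMap.flip_apply, Submodule.mkQ_apply, Submodule.liftQ_apply, LinearMap.compr₂_apply]
      rw [Submodule.Quotient.mk_eq_zero]
      refine ⟨fun g => β a (c₂.1 g), c₂.2.1.comp (fun n => β a n), fun f g => ?_⟩
      have ha' : c₁.1 f = ρM f a - a := ha f
      change β (c₁.1 f) (ρN f (c₂.1 g)) = _
      simp only [ha', ← hβ, c₂.2.2, map_add, map_sub, LinearMap.sub_apply]
      abel)

theorem cupH_mk {ρM : Representation k G M} {ρN : Representation k G N}
    {ρP : Representation k G P}
    (β : M →ₗ[k] N →ₗ[k] P) (hβ : ∀ g m n, β (ρM g m) (ρN g n) = ρP g (β m n))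
    (hN : IsDiscreteRep ρN) (c₁ : Z1 ρM) (c₂ : Z1 ρN) :
    cupH β hβ hN (cls1 c₁) (cls1 c₂) = cls2 (cupZ β hβ hN c₁ c₂) := rfl

end Cohomology

/-! ### Tate twists, the adjoint representation and the trace pairing -/

section Coefficients

variable {F : Type*} [Field F] {G : Type*} [Group G]

/-- The twist of a representation by a character. -/
def twist {M : Type*} [AddCommGroup M] [Module F M] (χ : G →* Fˣ) (ρ : Representation F G M) :
    Representation F G M where
  toFun g := (χ g : F) • ρ g
  map_one' := by simp
  map_mul' g h := by
    ext m
    change ((χ (g * h) : Fˣ) : F) • ρ (g * h) m = (χ g : F) • ρ g ((χ h : F) • ρ h m)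
    rw [map_mul, map_mul, Units.val_mul, mul_smul, map_smul]
    rfl

/-- The one-dimensional representation on which `G` acts through `χ`; for the mod `ℓ` cyclotomic
character this is `F(1)`. -/
abbrev charRep (χ : G →* Fˣ) : Representation F G F := twist χ (Representation.trivial F G F)

/-- The traceless `n × n` matrices. -/
abbrev Traceless (F : Type*) [Field F] (n : ℕ) : Submodule F (Matrix (Fin n) (Fin n) F) :=
  LinearMap.ker (Matrix.traceLinearMap (Fin n) F F)

/-- `ad⁰(r)`: the action of `G` on traceless matrices by conjugation through `r`. -/
def ad0 {n : ℕ} (r : G →* GL (Fin n) F) : Representation F G (Traceless F n) where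
  toFun g :=
    { toFun := fun A => ⟨(r g).1 * A.1 * (r g)⁻¹.1, by
        have hA : Matrix.trace A.1 = 0 := A.2
        change Matrix.trace ((r g).1 * A.1 * (r g)⁻¹.1) = 0
        rw [Matrix.trace_mul_comm, ← mul_assoc, ← Units.val_mul, inv_mul_cancel, Units.val_one,
          one_mul, hA]⟩
      map_add' := fun A B => by ext1; simp [mul_add, add_mul]
      map_smul' := fun c A => by ext1; simp }
  map_one' := by ext1 A; ext1; simp
  map_mul' g h := by
    ext1 A
    ext1
    change (r (g * h)).1 * A.1 * (r (g * h))⁻¹.1 =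
      (r g).1 * ((r h).1 * A.1 * (r h)⁻¹.1) * (r g)⁻¹.1
    simp only [map_mul, mul_inv_rev, Units.val_mul, mul_assoc]

/-- The bilinear form `(A, B) ↦ Trace (A B)` on traceless matrices. -/
def traceForm (F : Type*) [Field F] (n : ℕ) : Traceless F n →ₗ[F] Traceless F n →ₗ[F] F :=
  LinearMap.mk₂ F (fun A B => Matrix.trace (A.1 * B.1))
    (by intros; simp [add_mul]) (by intros; simp)
    (by intros; simp [mul_add]) (by intros; simp)

theorem traceForm_equivariant {n : ℕ} (r : G →* GL (Fin n) F) (χ : G →* Fˣ) (g : G)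
    (A B : Traceless F n) :
    traceForm F n (ad0 r g A) (twist χ (ad0 r) g B) = charRep χ g (traceForm F n A B) := by
  change Matrix.trace (((r g).1 * A.1 * (r g)⁻¹.1) * ((χ g : F) • ((r g).1 * B.1 * (r g)⁻¹.1)))
    = (χ g : F) • Matrix.trace (A.1 * B.1)
  rw [mul_smul_comm, Matrix.trace_smul]
  congr 1
  have h1 : (r g)⁻¹.1 * (r g).1 = 1 := by
    rw [← Units.val_mul, inv_mul_cancel, Units.val_one]
  calc Matrix.trace (((r g).1 * A.1 * (r g)⁻¹.1) * ((r g).1 * B.1 * (r g)⁻¹.1))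
      = Matrix.trace ((r g).1 * (A.1 * ((r g)⁻¹.1 * (r g).1) * (B.1 * (r g)⁻¹.1))) := by
        simp only [mul_assoc]
    _ = Matrix.trace (A.1 * B.1) := by
        rw [h1, mul_one, Matrix.trace_mul_comm, mul_assoc, mul_assoc, h1, mul_one]

variable [TopologicalSpace G]

theorem isDiscreteRep_twist_ad0 {n : ℕ} {r : G →* GL (Fin n) F} (hr : IsLocallyConstant r)
    {χ : G →* Fˣ} (hχ : IsLocallyConstant χ) : IsDiscreteRep (twist χ (ad0 r)) := fun m => by
  have h : (fun g => twist χ (ad0 r) g m) = fun g =>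
      (fun (x : Fˣ) (A : GL (Fin n) F) => (x : F) •
        ad0 (MonoidHom.id (GL (Fin n) F)) A m) (χ g) (r g) := rfl
  rw [h]
  exact IsLocallyConstant.comp₂ hχ hr (fun (x : Fˣ) (A : GL (Fin n) F) => (x : F) •
    ad0 (MonoidHom.id (GL (Fin n) F)) A m)

/-- The pairing `H¹(G, ad⁰(r)) × H¹(G, ad⁰(r)(1)) → H²(G, F(1))`: the cup product followed by the
map induced by the trace form. -/
def tracePairing {n : ℕ} (r : G →* GL (Fin n) F) (hr : IsLocallyConstant r)
    (χ : G →* Fˣ) (hχ : IsLocallyConstant χ) :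
    H1 (ad0 r) →ₗ[F] H1 (twist χ (ad0 r)) →ₗ[F] H2 (charRep χ) :=
  cupH (traceForm F n) (traceForm_equivariant r χ) (isDiscreteRep_twist_ad0 hr hχ)

end Coefficients

/-! ### The tame group `Ẑ' ⋊ Ẑ` -/

section TameGroup

/-- The completion `lim ℤ/m` of `ℤ`, where `m` runs through the set `S` ordered by divisibility. -/
def Completion (S : Set ℕ) : AddSubgroup (∀ m : S, ZMod m.1) where
  carrier := {x | ∀ (m m' : S) (h : m.1 ∣ m'.1), ZMod.castHom h (ZMod m.1) (x m') = x m}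
  zero_mem' := fun m m' h => map_zero _
  add_mem' := by
    intro a b ha hb m m' h
    rw [Pi.add_apply, map_add, ha m m' h, hb m m' h, Pi.add_apply]
  neg_mem' := by
    intro a ha m m' h
    rw [Pi.neg_apply, map_neg, ha m m' h, Pi.neg_apply]

/-- The element `1` of a completion of `ℤ`. -/
def Completion.one (S : Set ℕ) : Completion S := ⟨fun _ => 1, fun _ _ _ => map_one _⟩

/-- `Ẑ`, with the topology induced from the product of the discrete groups `ℤ/m`. -/
abbrev ZHat : Type := Completion {m : ℕ | 0 < m}

/-- The completion of `ℤ` prime to `q`; for a power `q > 1` of a prime `p` this is the prime-to-`p`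
completion `Ẑ'`. -/
abbrev ZHatPrime (q : ℕ) : Type := Completion {m : ℕ | 0 < m ∧ m.Coprime q}

/-- `u ↦ q ^ u` as a homomorphism `Ẑ → (ℤ/m)ˣ`, for `m > 0` prime to `q`. As the order of `q`
divides `φ(m)`, the exponent matters modulo `φ(m)` only. -/
def qPow (q m : ℕ) (hm : 0 < m) (h : m.Coprime q) : Multiplicative ZHat →* (ZMod m)ˣ where
  toFun u := ZMod.unitOfCoprime q h.symm ^
    ((Multiplicative.toAdd u).1 ⟨m.totient, Nat.totient_pos.2 hm⟩).val
  map_one' := by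
    change _ ^ (0 : ZMod m.totient).val = _
    rw [ZMod.val_zero, pow_zero]
  map_mul' u v := by
    have : NeZero m.totient := ⟨(Nat.totient_pos.2 hm).ne'⟩
    change _ ^ (_ + _ : ZMod m.totient).val = _
    rw [ZMod.val_add, ← pow_add]
    exact (pow_eq_pow_mod _ (ZMod.pow_totient _)).symm

theorem qPow_compat (q : ℕ) {m m' : ℕ} (hm : 0 < m) (h : m.Coprime q) (hm' : 0 < m')
    (h' : m'.Coprime q) (hd : m ∣ m') (u : Multiplicative ZHat) :
    ZMod.castHom hd (ZMod m) (qPow q m' hm' h' u : ZMod m') = (qPow q m hm h u : ZMod m) := by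
  have : NeZero m.totient := ⟨(Nat.totient_pos.2 hm).ne'⟩
  have : NeZero m'.totient := ⟨(Nat.totient_pos.2 hm').ne'⟩
  have hu := (Multiplicative.toAdd u).2 ⟨m.totient, Nat.totient_pos.2 hm⟩
    ⟨m'.totient, Nat.totient_pos.2 hm'⟩ (Nat.totient_dvd_of_dvd hd)
  have hv : ((Multiplicative.toAdd u).1 ⟨m.totient, Nat.totient_pos.2 hm⟩).val =
      ((Multiplicative.toAdd u).1 ⟨m'.totient, Nat.totient_pos.2 hm'⟩).val % m.totient := by
    rw [← hu, ZMod.castHom_apply, ZMod.cast_eq_val, ZMod.val_natCast]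
  have hpow : ∀ (e : ℕ), ((ZMod.unitOfCoprime q h.symm ^ e : (ZMod m)ˣ) : ZMod m) =
      (q : ZMod m) ^ e := fun e => by
    rw [Units.val_pow_eq_pow_val, ZMod.coe_unitOfCoprime]
  change ZMod.castHom hd (ZMod m) ((ZMod.unitOfCoprime q h'.symm ^ _ : (ZMod m')ˣ) : ZMod m') =
    ((ZMod.unitOfCoprime q h.symm ^ _ : (ZMod m)ˣ) : ZMod m)
  rw [hv, ← pow_eq_pow_mod _ (ZMod.pow_totient _), Units.val_pow_eq_pow_val,
    ZMod.coe_unitOfCoprime, map_pow, map_natCast, hpow]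

/-- `Ẑ` acts on `Ẑ'` by `u • x = q ^ u * x`. -/
instance zHatAction (q : ℕ) : DistribMulAction (Multiplicative ZHat) (ZHatPrime q) where
  smul u x := ⟨fun m => (qPow q m.1 m.2.1 m.2.2 u : ZMod m.1) * x.1 m, fun m m' h => by
    rw [map_mul, qPow_compat q m.2.1 m.2.2 m'.2.1 m'.2.2 h, x.2 m m' h]⟩
  one_smul x := by
    ext m
    change ((qPow q m.1 m.2.1 m.2.2 1 : (ZMod m.1)ˣ) : ZMod m.1) * x.1 m = x.1 m
    rw [map_one, Units.val_one, one_mul]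
  mul_smul u v x := by
    ext m
    change ((qPow q m.1 m.2.1 m.2.2 (u * v) : (ZMod m.1)ˣ) : ZMod m.1) * x.1 m =
      (qPow q m.1 m.2.1 m.2.2 u : ZMod m.1) * ((qPow q m.1 m.2.1 m.2.2 v : ZMod m.1) * x.1 m)
    rw [map_mul, Units.val_mul, mul_assoc]
  smul_zero u := by
    ext m
    exact mul_zero _
  smul_add u x y := by
    ext m
    exact mul_add _ _ _

/-- The action of `Ẑ` on `Ẑ'`, written multiplicatively. -/
def conjAction (q : ℕ) : Multiplicative ZHat →* MulAut (Multiplicative (ZHatPrime q)) where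
  toFun u := AddEquiv.toMultiplicative (DistribMulAction.toAddAut _ (ZHatPrime q) u)
  map_one' := by
    ext1 x
    exact congrArg Multiplicative.ofAdd (one_smul (Multiplicative ZHat) (Multiplicative.toAdd x))
  map_mul' u v := by
    ext1 x
    exact congrArg Multiplicative.ofAdd (mul_smul u v (Multiplicative.toAdd x))

/-- The tame group `Ẑ' ⋊ Ẑ`. -/
abbrev TameGroup (q : ℕ) : Type :=
  SemidirectProduct (Multiplicative (ZHatPrime q)) (Multiplicative ZHat) (conjAction q)

/-- The product topology on `Ẑ' ⋊ Ẑ`. -/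
instance tameGroupTopology (q : ℕ) : TopologicalSpace (TameGroup q) :=
  TopologicalSpace.induced SemidirectProduct.equivProd inferInstance

/-- The generator `s` of `Ẑ`. -/
def tameS (q : ℕ) : TameGroup q := SemidirectProduct.inr (Multiplicative.ofAdd (Completion.one _))

/-- The generator `t` of `Ẑ'`. -/
def tameT (q : ℕ) : TameGroup q := SemidirectProduct.inl (Multiplicative.ofAdd (Completion.one _))

/-- The defining relation of the tame group. -/
theorem tame_relation (q : ℕ) : tameS q * tameT q * (tameS q)⁻¹ = tameT q ^ q := by
  have h : tameS q * tameT q * (tameS q)⁻¹ = SemidirectProduct.inl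
      (conjAction q (Multiplicative.ofAdd (Completion.one _))
        (Multiplicative.ofAdd (Completion.one _))) := by
    rw [SemidirectProduct.inl_aut, map_inv]
    rfl
  rw [h, tameT, ← map_pow]
  congr 1
  apply Multiplicative.toAdd.injective
  apply Subtype.ext
  funext m
  change ((ZMod.unitOfCoprime q m.2.2.symm ^ (1 : ZMod m.1.totient).val : (ZMod m.1)ˣ) :
    ZMod m.1) * 1 = (q • (Completion.one {m : ℕ | 0 < m ∧ m.Coprime q})).1 m
  have hR : (q • (Completion.one {m : ℕ | 0 < m ∧ m.Coprime q})).1 m = q • (1 : ZMod m.1) := rfl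
  have hL : ZMod.unitOfCoprime q m.2.2.symm ^ (1 : ZMod m.1.totient).val =
      ZMod.unitOfCoprime q m.2.2.symm := by
    conv_rhs => rw [← pow_one (ZMod.unitOfCoprime q m.2.2.symm)]
    rw [ZMod.val_one_eq_one_mod]
    exact (pow_eq_pow_mod 1 (ZMod.pow_totient _)).symm
  rw [hR, hL, mul_one, ZMod.coe_unitOfCoprime, nsmul_eq_mul, mul_one]

/-- The mod `ℓ` cyclotomic character of the tame group, with values in a field `F` of
characteristic `ℓ`: `s ↦ q`, `t ↦ 1`. -/
def cyclotomic (F : Type*) [Field F] (ℓ q : ℕ) [hℓ : Fact ℓ.Prime] [CharP F ℓ]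
    (h : ℓ.Coprime q) : TameGroup q →* Fˣ :=
  ((Units.map (ZMod.castHom (dvd_refl ℓ) F).toMonoidHom).comp (qPow q ℓ hℓ.out.pos h)).comp
    SemidirectProduct.rightHom

theorem cyclotomic_locallyConstant (F : Type*) [Field F] (ℓ q : ℕ) [hℓ : Fact ℓ.Prime] [CharP F ℓ]
    (h : ℓ.Coprime q) : IsLocallyConstant (cyclotomic F ℓ q h) := by
  have hc : Continuous fun g : TameGroup q => (Multiplicative.toAdd g.right).1
      (⟨ℓ.totient, Nat.totient_pos.2 hℓ.out.pos⟩ : {m : ℕ | 0 < m}) := by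
    have h1 : Continuous (SemidirectProduct.equivProd (φ := conjAction q)) :=
      continuous_induced_dom
    exact (continuous_apply _).comp (continuous_subtype_val.comp
      (continuous_toAdd.comp (continuous_snd.comp h1)))
  have hl := (IsLocallyConstant.iff_continuous _).2 hc
  exact hl.comp (fun z : ZMod ℓ.totient => Units.map (ZMod.castHom (dvd_refl ℓ) F).toMonoidHom
    (ZMod.unitOfCoprime q h.symm ^ z.val))

theorem cyclotomic_tameS (F : Type*) [Field F] (ℓ q : ℕ) [hℓ : Fact ℓ.Prime] [CharP F ℓ]
    (h : ℓ.Coprime q) : ((cyclotomic F ℓ q h (tameS q) : Fˣ) : F) = q := by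
  change ZMod.castHom (dvd_refl ℓ) F
    ((ZMod.unitOfCoprime q h.symm ^ (1 : ZMod ℓ.totient).val : (ZMod ℓ)ˣ) : ZMod ℓ) = q
  have hL : ZMod.unitOfCoprime q h.symm ^ (1 : ZMod ℓ.totient).val =
      ZMod.unitOfCoprime q h.symm := by
    conv_rhs => rw [← pow_one (ZMod.unitOfCoprime q h.symm)]
    rw [ZMod.val_one_eq_one_mod]
    exact (pow_eq_pow_mod 1 (ZMod.pow_totient _)).symm
  rw [hL, ZMod.coe_unitOfCoprime, map_natCast]

end TameGroup

/-- A profinite group is pro-`p` if its quotients by open normal subgroups are `p`-groups. -/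
def IsProP (p : ℕ) (P : Type*) [Group P] [TopologicalSpace P] : Prop :=
  ∀ U : OpenNormalSubgroup P, IsPGroup p (P ⧸ U.toSubgroup)

end TameDuality

end

open TameDuality

/-! A normalized 2-cocycle comes from a finite quotient `Γ` of the tame group and defines an
extension of `Γ` by `F(1)`, again finite. Lift `s`, `t` to `S = (0, s)`, `T = (0, t)`; then `S T S⁻¹
= d T ^ q` with a scalar `d`. If `d = 0`, the relation holds upstairs, the universal property of `Ẑ'
⋊ Ẑ` gives a homomorphism to the extension over `Γ`, and its first coordinate trivializes the
cocycle. Iterating the relation `ℓ - 1` times multiplies the obstruction by `(ℓ - 1) q ^ (ℓ - 2)`, a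
nonzero element of `F`. Up to sign the result is the sum in the statement, so that sum detects the
class (`CocycleExtension.conj_lift_eq_pow`, `mem_B2_of_tameForm_eq_zero`). It kills coboundaries
because `q ^ (ℓ - 1) = 1` in `F`, and an explicit cup product has value `1`.

On a cup product with `t` acting trivially, `c₁(t ^ i) = i c₁(t)`, and `s` multiplies `c₁(t)` and
`c₂(t)` by `q`. The formula then collapses to two mixed terms plus `Q (Q - 1) / 2` times the `t`-`t`
term, with `Q = q ^ (ℓ - 1)` (`tameForm_cupZ`). That coefficient is nonzero in `F` only for `ℓ = 2`,
`q ≡ 3 mod 4`.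

For the profinite group `G`, the kernel is pro-`p` and `p` is invertible in `F`. Hence the kernel
has no nonzero continuous homomorphisms to coefficient modules, and cochains can be averaged over
it. This makes inflation bijective in degrees one and two (`inflH1_bijective`, `inflH2_bijective`).
-/

namespace TameDuality

/-! ### Uniform local constancy on profinite groups. -/

section LocallyConstant

/-- A locally constant function on a compact group is uniformly locally constant. -/
theorem exists_isOpen_forall_mul_eq {H X : Type*} [Group H] [TopologicalSpace H]
    [IsTopologicalGroup H] [CompactSpace H] {φ : H → X} (hφ : IsLocallyConstant φ) :
    ∃ W : Set H, IsOpen W ∧ 1 ∈ W ∧ ∀ h, ∀ w ∈ W, φ (h * w) = φ h := by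
  have h1 : IsLocallyConstant fun x : H × H => (φ (x.1 * x.2), φ x.1) :=
    (hφ.comp_continuous continuous_mul).prodMk (hφ.comp_continuous continuous_fst)
  -- The pairs `(h, w)` with `φ (h * w) = φ h` form an open set containing `H × {1}`; by compactness
  -- it contains a tube.
  obtain ⟨u, v, -, hv, hu', hv', huv⟩ := generalized_tube_lemma (isCompact_univ (X := H))
    (isCompact_singleton (x := (1 : H))) (h1 {y | y.1 = y.2}) (by
      rintro ⟨h, w⟩ ⟨-, hw⟩
      obtain rfl : w = 1 := hw
      exact congrArg φ (mul_one h))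
  exact ⟨v, hv, hv' rfl, fun h w hw => huv (show (h, w) ∈ u ×ˢ v from ⟨hu' trivial, hw⟩)⟩

variable {G : Type*} [Group G] [TopologicalSpace G] [IsTopologicalGroup G] [CompactSpace G]
  [TotallyDisconnectedSpace G]

/-- A locally constant function of two variables in a profinite group factors through a finite
quotient in both variables. -/
theorem exists_openNormalSubgroup_forall_mul_eq {X : Type*} {φ : G × G → X}
    (hφ : IsLocallyConstant φ) :
    ∃ U : OpenNormalSubgroup G, ∀ g h, ∀ u ∈ U, ∀ v ∈ U, φ (g * u, h * v) = φ (g, h) := by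
  obtain ⟨W, hW, h1, hinv⟩ := exists_isOpen_forall_mul_eq hφ
  obtain ⟨u, v, hu, hv, hu1, hv1, huv⟩ := isOpen_prod_iff.1 hW 1 1 h1
  obtain ⟨U, hU⟩ := ProfiniteGrp.exist_openNormalSubgroup_sub_open_nhds_of_one
    (hu.inter hv) ⟨hu1, hv1⟩
  exact ⟨U, fun g h a ha b hb => hinv (g, h) (a, b) (huv ⟨(hU ha).1, (hU hb).2⟩)⟩

/-- A function on a topological group is locally constant if it is invariant under translation by
an open subgroup. -/
theorem isLocallyConstant_of_forall_mul_eq {G X : Type*} [Group G] [TopologicalSpace G]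
    [IsTopologicalGroup G] {U : Subgroup G} (hU : IsOpen (U : Set G)) {φ : G → X}
    (h : ∀ g, ∀ u ∈ U, φ (g * u) = φ g) : IsLocallyConstant φ := by
  rw [IsLocallyConstant.iff_exists_open]
  intro x
  refine ⟨(fun y => x⁻¹ * y) ⁻¹' U, hU.preimage (continuous_const_mul _), by simp, fun y hy => ?_⟩
  rw [← h x _ hy, mul_inv_cancel_left]

theorem IsLocallyConstant.of_comp_isQuotientMap {X Y Z : Type*} [TopologicalSpace X]
    [TopologicalSpace Y] {f : X → Y} (hf : Topology.IsQuotientMap f) {φ : Y → Z}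
    (h : IsLocallyConstant (φ ∘ f)) : IsLocallyConstant φ := fun s =>
  hf.isOpen_preimage.1 (h s)

end LocallyConstant

/-! ### Averaging over pro-`p` groups. -/

section Average

variable {p : ℕ} {F : Type*} [Field F] {M : Type*} [AddCommGroup M] [Module F M]
  {K : Type*} [Group K] [TopologicalSpace K]

/-- Functions on a pro-`p` group that are invariant under an open normal subgroup can be averaged
over the group, if `p` is invertible in the coefficients. -/
theorem IsProP.exists_average [Fact p.Prime] [IsTopologicalGroup K] [CompactSpace K] (hK : IsProP p K) (hpF : (p : F) ≠ 0)
    (V : OpenNormalSubgroup K) :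
    ∃ A : (K → M) →ₗ[F] M, (∀ m, A (fun _ => m) = m) ∧
      (∀ (L : M →ₗ[F] M) φ, A (fun k => L (φ k)) = L (A φ)) ∧
      ∀ φ : K → M, (∀ k, ∀ v ∈ V, φ (k * v) = φ k) → ∀ y,
        A (fun k => φ (y * k)) = A φ ∧ A (fun k => φ (k * y)) = A φ := by
  classical
  have hfin : Finite (K ⧸ V.toSubgroup) :=
    Subgroup.quotient_finite_of_isOpen _ V.toOpenSubgroup.isOpen
  have := Fintype.ofFinite (K ⧸ V.toSubgroup)
  obtain ⟨a, ha⟩ := (hK V).exists_card_eq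
  have hcard : ((Fintype.card (K ⧸ V.toSubgroup) : ℕ) : F) ≠ 0 := by
    rw [← Nat.card_eq_fintype_card, ha, Nat.cast_pow]
    exact pow_ne_zero _ hpF
  -- The mean over chosen coset representatives is linear on all functions; only on `V`-invariant
  -- ones is it independent of the choice and translation invariant.
  refine ⟨((Fintype.card (K ⧸ V.toSubgroup) : F))⁻¹ •
    ∑ x : K ⧸ V.toSubgroup, LinearMap.proj x.out, fun m => ?_, fun L φ => ?_, fun φ hφ y => ?_⟩
  · simp only [LinearMap.smul_apply, LinearMap.sum_apply, LinearMap.proj_apply, Finset.sum_const,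
      Finset.card_univ]
    rw [← Nat.cast_smul_eq_nsmul F, smul_smul, inv_mul_cancel₀ hcard, one_smul]
  · simp [map_sum]
  · obtain ⟨ψ, hψ⟩ : ∃ ψ : K ⧸ V.toSubgroup → M, ∀ k : K, ψ k = φ k :=
      ⟨Quotient.lift φ (by
        intro a b hab
        have h1 := hφ a _ (QuotientGroup.leftRel_apply.1 hab)
        rw [mul_inv_cancel_left] at h1
        exact h1.symm), fun _ => rfl⟩
    simp only [LinearMap.smul_apply, LinearMap.sum_apply, LinearMap.proj_apply, ← hψ,
      QuotientGroup.mk_mul, QuotientGroup.out_eq']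
    exact ⟨congrArg _ (Equiv.sum_comp (Equiv.mulLeft (y : K ⧸ V.toSubgroup)) ψ),
      congrArg _ (Equiv.sum_comp (Equiv.mulRight (y : K ⧸ V.toSubgroup)) ψ)⟩

/-- A locally constant homomorphism from a pro-`p` group to a vector space in which `p` is
invertible is trivial. -/
theorem IsProP.map_eq_zero (hK : IsProP p K) (hpF : (p : F) ≠ 0) {φ : K → M}
    (hφ : IsLocallyConstant φ) (hmul : ∀ a b, φ (a * b) = φ a + φ b) (k : K) : φ k = 0 := by
  let f : K →* Multiplicative M := MonoidHom.mk' (fun k => Multiplicative.ofAdd (φ k)) hmul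
  let V : OpenNormalSubgroup K := ⟨⟨f.ker, hφ.isOpen_fiber 0⟩, inferInstance⟩
  obtain ⟨a, ha⟩ := hK V (k : K ⧸ V.toSubgroup)
  rw [← QuotientGroup.mk_pow, QuotientGroup.eq_one_iff] at ha
  have h1 : f (k ^ p ^ a) = 1 := ha
  rw [map_pow] at h1
  have h2 : (p ^ a) • φ k = 0 := h1
  rw [← Nat.cast_smul_eq_nsmul F, Nat.cast_pow] at h2
  exact (smul_eq_zero.1 h2).resolve_left (pow_ne_zero _ hpF)

end Average

/-! ### Descent along a surjection, and inflation in degree one. -/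

section Inflation

variable {p : ℕ} {F : Type*} [Field F] {M : Type*} [AddCommGroup M] [Module F M]
  {G : Type*} [Group G] [TopologicalSpace G] {H : Type*} [Group H] [TopologicalSpace H]
  {π : G →ₜ* H} {ρ : Representation F H M} {ρ' : Representation F G M}

theorem map_eq_map_iff_exists_ker (π : G →ₜ* H) {a b : G} :
    π a = π b ↔ ∃ k : π.toMonoidHom.ker, b = a * k := by
  constructor
  · intro h
    refine ⟨⟨a⁻¹ * b, ?_⟩, by simp⟩
    rw [MonoidHom.mem_ker]
    change π (a⁻¹ * b) = 1
    rw [map_mul, ← h, ← map_mul, inv_mul_cancel, map_one]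
  · rintro ⟨k, rfl⟩
    have hk : π k = 1 := k.2
    rw [map_mul, hk, mul_one]

theorem apply_ker_eq (h : ∀ g, ρ' g = ρ (π g)) (k : π.toMonoidHom.ker) (m : M) :
    ρ' k m = m := by
  have hk : π k = 1 := k.2
  rw [h, hk, map_one, Module.End.one_apply]

variable [CompactSpace G]

theorem compactSpace_ker [T1Space H] (π : G →ₜ* H) : CompactSpace π.toMonoidHom.ker :=
  isCompact_iff_compactSpace.1 (isClosed_singleton.preimage π.continuous_toFun).isCompact

variable [T2Space H]

theorem isQuotientMap_of_surjective (hπ : Function.Surjective π) : Topology.IsQuotientMap π :=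
  π.continuous_toFun.isClosedMap.isQuotientMap π.continuous_toFun hπ

theorem isQuotientMap_prodMap_of_surjective (hπ : Function.Surjective π) :
    Topology.IsQuotientMap (Prod.map π π) :=
  have hc : Continuous (Prod.map π π) := π.continuous_toFun.prodMap π.continuous_toFun
  hc.isClosedMap.isQuotientMap hc (hπ.prodMap hπ)

/-- The set-theoretic section need not be continuous. Local constancy descends because a continuous
surjection from a compact to a Hausdorff space is a quotient map. -/
theorem exists_factor_of_forall_mul_ker (hπ : Function.Surjective π) {X : Type*} {φ : G → X}
    (hφ : IsLocallyConstant φ) (h : ∀ g (k : π.toMonoidHom.ker), φ (g * k) = φ g) :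
    ∃ ψ : H → X, IsLocallyConstant ψ ∧ ∀ g, ψ (π g) = φ g := by
  have hfac : Function.FactorsThrough φ π := by
    intro a b hab
    obtain ⟨k, rfl⟩ := (map_eq_map_iff_exists_ker π).1 hab
    exact (h a k).symm
  have heq : ∀ g, (φ ∘ Function.surjInv hπ) (π g) = φ g := fun g =>
    hfac (Function.surjInv_eq hπ _)
  refine ⟨φ ∘ Function.surjInv hπ, ?_, heq⟩
  refine IsLocallyConstant.of_comp_isQuotientMap (isQuotientMap_of_surjective hπ) ?_
  rw [show (φ ∘ Function.surjInv hπ) ∘ π = φ from funext heq]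
  exact hφ

theorem exists_factor₂_of_forall_mul_ker (hπ : Function.Surjective π) {X : Type*}
    {φ : G × G → X} (hφ : IsLocallyConstant φ)
    (h₁ : ∀ f g (k : π.toMonoidHom.ker), φ (f * k, g) = φ (f, g))
    (h₂ : ∀ f g (k : π.toMonoidHom.ker), φ (f, g * k) = φ (f, g)) :
    ∃ ψ : H × H → X, IsLocallyConstant ψ ∧ ∀ f g, ψ (π f, π g) = φ (f, g) := by
  have hfac : ∀ a b a' b', π a = π a' → π b = π b' → φ (a, b) = φ (a', b') := by
    intro a b a' b' ha hb
    obtain ⟨k, rfl⟩ := (map_eq_map_iff_exists_ker π).1 ha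
    obtain ⟨k', rfl⟩ := (map_eq_map_iff_exists_ker π).1 hb
    rw [h₁, h₂]
  set σ := Function.surjInv hπ with hσ
  have heq : ∀ f g, (φ ∘ Prod.map σ σ) (π f, π g) = φ (f, g) := fun f g =>
    hfac _ _ _ _ (Function.surjInv_eq hπ _) (Function.surjInv_eq hπ _)
  refine ⟨φ ∘ Prod.map σ σ, ?_, heq⟩
  refine IsLocallyConstant.of_comp_isQuotientMap (isQuotientMap_prodMap_of_surjective hπ) ?_
  rw [show (φ ∘ Prod.map σ σ) ∘ Prod.map π π = φ from funext fun x => heq x.1 x.2]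
  exact hφ


/-- Injectivity is formal. For surjectivity, the kernel acts trivially, so a cocycle restricts to it
as a homomorphism; this vanishes, and the cocycle descends. -/
theorem inflH1_bijective (h : ∀ g, ρ' g = ρ (π g)) (hπ : Function.Surjective π) (hK : IsProP p π.toMonoidHom.ker)
    (hpF : (p : F) ≠ 0) : Function.Bijective (inflH1 ρ ρ' π h) := by
  constructor
  · rw [injective_iff_map_eq_zero]
    intro x
    obtain ⟨c, rfl⟩ := Submodule.mkQ_surjective _ x
    intro hx
    obtain ⟨a, ha⟩ := (Submodule.Quotient.mk_eq_zero _).1 hx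
    refine (Submodule.Quotient.mk_eq_zero _).2 ⟨a, fun g => ?_⟩
    obtain ⟨g, rfl⟩ := hπ g
    rw [← h]
    exact ha g
  · intro x
    obtain ⟨c, rfl⟩ := Submodule.mkQ_surjective _ x
    have h0 : ∀ k : π.toMonoidHom.ker, c.1 k = 0 :=
      hK.map_eq_zero hpF (φ := fun k : π.toMonoidHom.ker => c.1 k)
        (c.2.1.comp_continuous continuous_subtype_val) fun a b => by
          rw [Subgroup.coe_mul, c.2.2, apply_ker_eq h]
    obtain ⟨d, hd, hdc⟩ := exists_factor_of_forall_mul_ker hπ c.2.1 fun g k => by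
      rw [c.2.2, h0, map_zero, add_zero]
    refine ⟨cls1 ⟨d, hd, fun f g => ?_⟩, ?_⟩
    · obtain ⟨f, rfl⟩ := hπ f
      obtain ⟨g, rfl⟩ := hπ g
      rw [← map_mul, hdc, hdc, hdc, ← h, c.2.2]
    · refine congrArg (Submodule.mkQ _) (Subtype.ext (funext hdc))

end Inflation

/-! ### Inflation in degree two. -/

section InflationTwo

variable {p : ℕ} [Fact p.Prime] {F : Type*} [Field F] {M : Type*} [AddCommGroup M] [Module F M]
  {G : Type*} [Group G] [TopologicalSpace G] {H : Type*} [Group H] [TopologicalSpace H]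
  {π : G →ₜ* H} {ρ : Representation F H M} {ρ' : Representation F G M}

/-- The restriction of an open normal subgroup to a subgroup. -/
def restrictOpenNormal (U : OpenNormalSubgroup G) (K : Subgroup G) : OpenNormalSubgroup K where
  toSubgroup := U.toSubgroup.subgroupOf K
  isOpen' := U.toOpenSubgroup.isOpen.preimage continuous_subtype_val
  isNormal' := inferInstance

variable [CompactSpace G] [IsTopologicalGroup G] [TotallyDisconnectedSpace G]

/-- A 2-cocycle becomes invariant under the pro-`p` kernel in the second variable after adding a
coboundary. -/
theorem exists_invariant_right [T1Space H] (hK : IsProP p π.toMonoidHom.ker) (hpF : (p : F) ≠ 0)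
    (hρ : IsDiscreteRep ρ') (c : Z2 ρ') :
    ∃ c' : Z2 ρ', c'.1 - c.1 ∈ B2 ρ' ∧
      ∀ f g (k : π.toMonoidHom.ker), c'.1 (f, g * k) = c'.1 (f, g) := by
  have := compactSpace_ker π
  obtain ⟨U, hU⟩ := exists_openNormalSubgroup_forall_mul_eq c.2.1
  obtain ⟨A, hA1, hAL, hAinv⟩ := hK.exists_average (M := M) hpF (restrictOpenNormal U _)
  have hb : IsLocallyConstant fun g => A fun k => c.1 (g, k) :=
    isLocallyConstant_of_forall_mul_eq U.toOpenSubgroup.isOpen fun g u hu => by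
      congr 1
      ext k
      simpa using hU g k u hu 1 (one_mem U)
  -- Put `b g = A (c (g, ·))` and average the cocycle identity over its last argument: `c - ∂b`
  -- depends on `g` only through an average over the coset of `g`.
  have key : ∀ f g, c.1 (f, g) - (ρ' f (A fun k => c.1 (g, k)) - (A fun k => c.1 (f * g, k)) +
      A fun k => c.1 (f, k)) = (A fun k => c.1 (f, g * k)) - A fun k => c.1 (f, k) := by
    intro f g
    have h1 : A (fun k => ρ' f (c.1 (g, k)) - c.1 (f * g, k) + c.1 (f, g * k) - c.1 (f, g)) =
        A (fun _ => 0) := by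
      congr 1
      ext k
      exact c.2.2 f g k
    rw [hA1, show (fun k : π.toMonoidHom.ker => ρ' f (c.1 (g, k)) - c.1 (f * g, k) +
      c.1 (f, g * k) - c.1 (f, g)) = (fun k : π.toMonoidHom.ker => ρ' f (c.1 (g, k))) -
        (fun k : π.toMonoidHom.ker => c.1 (f * g, k)) +
        (fun k : π.toMonoidHom.ker => c.1 (f, g * k)) - fun _ => c.1 (f, g) from rfl,
      map_sub, map_add, map_sub, hAL, hA1] at h1
    rw [← sub_eq_zero, ← neg_eq_zero, ← h1]
    abel
  let d : G × G → M := fun x => ρ' x.1 (A fun k => c.1 (x.2, k)) -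
    (A fun k => c.1 (x.1 * x.2, k)) + A fun k => c.1 (x.1, k)
  have hdB : d ∈ B2 ρ' := ⟨_, hb, fun _ _ => rfl⟩
  have hdZ : d ∈ Z2 ρ' := by
    refine ⟨((hρ.locallyConstant continuous_fst (hb.comp_continuous continuous_snd)).sub
      (hb.comp_continuous continuous_mul)).add (hb.comp_continuous continuous_fst),
      fun f g k => ?_⟩
    simp only [d, map_add, map_sub, map_mul, Module.End.mul_apply, mul_assoc]
    abel
  refine ⟨c - ⟨d, hdZ⟩, ?_, fun f g k => ?_⟩
  · rw [show (c - ⟨d, hdZ⟩ : Z2 ρ').1 - c.1 = -d by simp]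
    exact neg_mem hdB
  · change c.1 (f, g * k) - d (f, g * k) = c.1 (f, g) - d (f, g)
    rw [key, key]
    congr 1
    have h2 := (hAinv (fun k => c.1 (f, g * k)) (fun k v hv => by
      rw [Subgroup.coe_mul, ← mul_assoc]
      simpa using hU f (g * k) 1 (one_mem U) v hv) k).1
    rw [← h2]
    simp only [Subgroup.coe_mul, mul_assoc]

/-- A 2-cocycle becomes invariant under the pro-`p` kernel in both variables after adding a
coboundary. -/
theorem exists_invariant [T1Space H] (h : ∀ g, ρ' g = ρ (π g)) (hK : IsProP p π.toMonoidHom.ker) (hpF : (p : F) ≠ 0)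
    (hρ : IsDiscreteRep ρ') (c : Z2 ρ') :
    ∃ c' : Z2 ρ', c'.1 - c.1 ∈ B2 ρ' ∧
      (∀ f g (k : π.toMonoidHom.ker), c'.1 (f * k, g) = c'.1 (f, g)) ∧
      ∀ f g (k : π.toMonoidHom.ker), c'.1 (f, g * k) = c'.1 (f, g) := by
  have := compactSpace_ker π
  obtain ⟨c₀, hc₀, hinv⟩ := exists_invariant_right hK hpF hρ c
  obtain ⟨U, hU⟩ := exists_openNormalSubgroup_forall_mul_eq c₀.2.1
  obtain ⟨A, hA1, hAL, hAinv⟩ := hK.exists_average (M := M) hpF (restrictOpenNormal U _)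
  have hb : IsLocallyConstant fun g => A fun k => c₀.1 (k, g) :=
    isLocallyConstant_of_forall_mul_eq U.toOpenSubgroup.isOpen fun g u hu => by
      congr 1
      ext k
      simpa using hU k g 1 (one_mem U) u hu
  -- Now the first argument is averaged. The kernel acts trivially, so the leading term of the
  -- cocycle identity is just `c₀ (f, g)`.
  have key : ∀ f g, c₀.1 (f, g) - (ρ' f (A fun k => c₀.1 (k, g)) - (A fun k => c₀.1 (k, f * g)) +
      A fun k => c₀.1 (k, f)) = (A fun k => c₀.1 (k * f, g)) - ρ' f (A fun k => c₀.1 (k, g)) := by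
    intro f g
    have h1 : A (fun k => c₀.1 (f, g) - c₀.1 (k * f, g) + c₀.1 (k, f * g) - c₀.1 (k, f)) =
        A (fun _ => 0) := by
      congr 1
      ext k
      have h2 := c₀.2.2 k f g
      rwa [apply_ker_eq h] at h2
    rw [hA1, show (fun k : π.toMonoidHom.ker => c₀.1 (f, g) - c₀.1 (k * f, g) +
      c₀.1 (k, f * g) - c₀.1 (k, f)) = (fun _ => c₀.1 (f, g)) -
        (fun k : π.toMonoidHom.ker => c₀.1 (k * f, g)) +
        (fun k : π.toMonoidHom.ker => c₀.1 (k, f * g)) -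
        fun k : π.toMonoidHom.ker => c₀.1 (k, f) from rfl,
      map_sub, map_add, map_sub, hA1] at h1
    rw [← sub_eq_zero, ← h1]
    abel
  let d : G × G → M := fun x => ρ' x.1 (A fun k => c₀.1 (k, x.2)) -
    (A fun k => c₀.1 (k, x.1 * x.2)) + A fun k => c₀.1 (k, x.1)
  have hdB : d ∈ B2 ρ' := ⟨_, hb, fun _ _ => rfl⟩
  have hdZ : d ∈ Z2 ρ' := by
    refine ⟨((hρ.locallyConstant continuous_fst (hb.comp_continuous continuous_snd)).sub
      (hb.comp_continuous continuous_mul)).add (hb.comp_continuous continuous_fst),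
      fun f g k => ?_⟩
    simp only [d, map_add, map_sub, map_mul, Module.End.mul_apply, mul_assoc]
    abel
  refine ⟨c₀ - ⟨d, hdZ⟩, ?_, fun f g k => ?_, fun f g k => ?_⟩
  · rw [show (c₀ - ⟨d, hdZ⟩ : Z2 ρ').1 - c.1 = -d + (c₀.1 - c.1) by
      rw [Submodule.coe_sub]; abel]
    exact add_mem (neg_mem hdB) hc₀
  · change c₀.1 (f * k, g) - d (f * k, g) = c₀.1 (f, g) - d (f, g)
    rw [key, key, map_mul, Module.End.mul_apply, apply_ker_eq h]
    congr 1
    -- Moving `k` past `f` replaces it by a conjugate in the kernel, which the average absorbs as a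
    -- right translation.
    have hk : f * k * f⁻¹ ∈ π.toMonoidHom.ker :=
      (MonoidHom.normal_ker π.toMonoidHom).conj_mem _ k.2 _
    have h2 := (hAinv (fun k => c₀.1 (k * f, g)) (fun k v hv => by
      rw [Subgroup.coe_mul, show (k : G) * v * f = k * f * (f⁻¹ * v * f) by group]
      simpa using hU (k * f) g _ (by
        have h3 := U.isNormal'.conj_mem _ hv f⁻¹
        rwa [inv_inv] at h3) 1 (one_mem U)) ⟨_, hk⟩).2
    rw [← h2]
    simp only [Subgroup.coe_mul, mul_assoc, inv_mul_cancel, mul_one]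
  · change c₀.1 (f, g * k) - d (f, g * k) = c₀.1 (f, g) - d (f, g)
    rw [key, key]
    simp only [hinv]

variable [T2Space H]

/-- Surjectivity is the averaging of `exists_invariant`. For injectivity, a cochain `b` bounding an
inflated cocycle is shown to be constant on cosets of the kernel. -/
theorem inflH2_bijective (h : ∀ g, ρ' g = ρ (π g)) (hπ : Function.Surjective π) (hK : IsProP p π.toMonoidHom.ker)
    (hpF : (p : F) ≠ 0) (hρ : IsDiscreteRep ρ') : Function.Bijective (inflH2 ρ ρ' π h) := by
  constructor
  · rw [injective_iff_map_eq_zero]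
    intro x
    obtain ⟨c, rfl⟩ := Submodule.mkQ_surjective _ x
    intro hx
    obtain ⟨b, hb, hbc⟩ := (Submodule.Quotient.mk_eq_zero _).1 hx
    replace hbc : ∀ f g, c.1 (π f, π g) = ρ' f (b g) - b (f * g) + b f := hbc
    -- The cocycle is not assumed normalized, so it is `b - c (1, 1)`, not `b`, that is additive on
    -- the kernel.
    have hc1 : ∀ f, c.1 (f, 1) = ρ f (c.1 (1, 1)) := fun f => by
      have := c.2.2 f 1 1
      simp only [mul_one] at this
      rw [sub_add_cancel, sub_eq_zero] at this
      exact this.symm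
    have hk : ∀ g (k : π.toMonoidHom.ker), b (g * k) = ρ' g (b k) + b g - ρ' g (c.1 (1, 1)) :=
      fun g k => by
        have h1 := hbc g k
        have hk1 : π k = 1 := k.2
        rw [hk1, hc1, ← h] at h1
        rw [h1]
        abel
    have h0 : ∀ k : π.toMonoidHom.ker, b k - c.1 (1, 1) = 0 :=
      hK.map_eq_zero hpF (φ := fun k : π.toMonoidHom.ker => b k - c.1 (1, 1))
        ((hb.comp_continuous continuous_subtype_val).sub (IsLocallyConstant.const _)) fun k l => by
          simp only [Subgroup.coe_mul, hk, apply_ker_eq h]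
          abel
    obtain ⟨d, hd, hdb⟩ := exists_factor_of_forall_mul_ker hπ hb fun g k => by
      rw [hk, sub_eq_zero.1 (h0 k)]
      abel
    refine (Submodule.Quotient.mk_eq_zero _).2 ⟨d, hd, fun f g => ?_⟩
    obtain ⟨f, rfl⟩ := hπ f
    obtain ⟨g, rfl⟩ := hπ g
    rw [← map_mul, hdb, hdb, hdb, ← h]
    exact hbc f g
  · intro x
    obtain ⟨c, rfl⟩ := Submodule.mkQ_surjective _ x
    obtain ⟨c', hcc', h1, h2⟩ := exists_invariant h hK hpF hρ c
    obtain ⟨d, hd, hdc⟩ := exists_factor₂_of_forall_mul_ker hπ c'.2.1 h1 h2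
    refine ⟨cls2 ⟨d, hd, fun f g k => ?_⟩, (Submodule.Quotient.eq _).2 ?_⟩
    · obtain ⟨f, rfl⟩ := hπ f
      obtain ⟨g, rfl⟩ := hπ g
      obtain ⟨k, rfl⟩ := hπ k
      rw [← map_mul, ← map_mul, hdc, hdc, hdc, hdc, ← h]
      exact c'.2.2 f g k
    · change (inflZ2 π h _ : Z2 ρ').1 - c.1 ∈ B2 ρ'
      convert hcc' using 2
      exact funext fun x => hdc x.1 x.2

end InflationTwo

/-! ### Completions of `ℤ`. -/

section Completion

variable {S : Set ℕ}

instance completion_compactSpace [∀ m : S, NeZero m.1] : CompactSpace (Completion S) := by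
  refine isCompact_iff_compactSpace.1 (IsClosed.isCompact ?_)
  have : (Completion S : Set (∀ m : S, ZMod m.1)) = ⋂ (m : S) (m' : S) (h : m.1 ∣ m'.1),
      {x | ZMod.castHom h (ZMod m.1) (x m') = x m} := by
    ext x
    simp only [Set.mem_iInter]
    rfl
  rw [this]
  refine isClosed_iInter fun m => isClosed_iInter fun m' => isClosed_iInter fun h =>
    isClosed_eq (continuous_of_discreteTopology.comp (continuous_apply m')) (continuous_apply m)

theorem Completion.continuous_apply (m : S) : Continuous fun x : Completion S => x.1 m :=
  (_root_.continuous_apply m).comp continuous_subtype_val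

theorem Completion.nsmul_one_apply (n : ℕ) (m : S) :
    (n • Completion.one S).1 m = n := by
  change n • (1 : ZMod m.1) = n
  rw [nsmul_eq_mul, mul_one]

/-- The subgroups `{x | x m = 0}` form a basis of neighbourhoods of `0` in a completion of `ℤ`. -/
theorem Completion.exists_forall_apply_eq_zero (h1 : 1 ∈ S)
    (hmul : ∀ a ∈ S, ∀ b ∈ S, a * b ∈ S) {U : Set (Completion S)} (hU : IsOpen U)
    (h0 : 0 ∈ U) : ∃ m : S, ∀ x : Completion S, x.1 m = 0 → x ∈ U := by
  obtain ⟨V, hV, rfl⟩ := isOpen_induced_iff.1 hU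
  obtain ⟨I, u, hu, hIV⟩ := isOpen_pi_iff.1 hV 0 h0
  -- A basic open set restricts finitely many coordinates; the coordinate at the product of their
  -- indices determines them all.
  have hprod : ∏ m ∈ I, m.1 ∈ S :=
    Finset.prod_induction _ (· ∈ S) (fun a b ha hb => hmul a ha b hb) h1 fun m _ => m.2
  refine ⟨⟨_, hprod⟩, fun x hx => hIV fun m hm => ?_⟩
  have h2 := x.2 m ⟨_, hprod⟩ (Finset.dvd_prod_of_mem _ hm)
  rw [hx, map_zero] at h2
  rw [← h2]
  exact (hu m hm).2

/-- A locally constant homomorphism on a completion of `ℤ` factors through some `ℤ/m`. -/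
theorem Completion.exists_forall_map_eq_pow (h1 : 1 ∈ S) (hmul : ∀ a ∈ S, ∀ b ∈ S, a * b ∈ S)
    (h0 : ∀ m ∈ S, 0 < m) {E : Type*} [Group E] {φ : Multiplicative (Completion S) →* E}
    (hφ : IsLocallyConstant φ) :
    ∃ m : S, ∀ x : Completion S, φ (Multiplicative.ofAdd x) =
      φ (Multiplicative.ofAdd (Completion.one S)) ^ (x.1 m).val := by
  obtain ⟨m, hm⟩ := Completion.exists_forall_apply_eq_zero h1 hmul
    (U := {x | φ (Multiplicative.ofAdd x) = 1}) (hφ {1}) (map_one φ)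
  have : NeZero m.1 := ⟨(h0 m m.2).ne'⟩
  refine ⟨m, fun x => ?_⟩
  -- `x` and the integer `(x m).val` have the same `m`-th coordinate, so they differ by an element
  -- of the kernel of `φ`.
  have h2 := hm (x - (x.1 m).val • Completion.one S) (by
    change x.1 m - ((x.1 m).val • Completion.one S).1 m = 0
    rw [Completion.nsmul_one_apply, ZMod.natCast_zmod_val, sub_self])
  rw [Set.mem_ofPred_eq, ofAdd_sub, map_div, div_eq_one, ofAdd_nsmul, map_pow] at h2
  exact h2

theorem Completion.map_one_pow_eq_one {E : Type*} [Group E]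
    {φ : Multiplicative (Completion S) →* E} {m : S}
    (h : ∀ x : Completion S, φ (Multiplicative.ofAdd x) =
      φ (Multiplicative.ofAdd (Completion.one S)) ^ (x.1 m).val) :
    φ (Multiplicative.ofAdd (Completion.one S)) ^ m.1 = 1 := by
  have h1 := h (m.1 • Completion.one S)
  rwa [Completion.nsmul_one_apply, ZMod.natCast_self, ZMod.val_zero, pow_zero, ofAdd_nsmul,
    map_pow] at h1

/-- The homomorphism from a completion of `ℤ` that sends `1` to an element whose order divides an
index of the completion. -/
def Completion.powHom {E : Type*} [Group E] (m : S) [NeZero m.1] (g : E) (hg : g ^ m.1 = 1) :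
    Multiplicative (Completion S) →* E where
  toFun x := g ^ ((Multiplicative.toAdd x).1 m).val
  map_one' := by
    change g ^ (0 : ZMod m.1).val = 1
    rw [ZMod.val_zero, pow_zero]
  map_mul' x y := by
    change g ^ (_ + _ : ZMod m.1).val = _
    rw [ZMod.val_add, ← pow_add]
    exact (pow_eq_pow_mod _ hg).symm

theorem Completion.powHom_one {E : Type*} [Group E] (m : S) [NeZero m.1] (g : E)
    (hg : g ^ m.1 = 1) :
    Completion.powHom m g hg (Multiplicative.ofAdd (Completion.one S)) = g := by
  change g ^ (1 : ZMod m.1).val = g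
  rw [ZMod.val_one_eq_one_mod, ← pow_eq_pow_mod _ hg, pow_one]

theorem Completion.isLocallyConstant_powHom {E : Type*} [Group E] (m : S) [NeZero m.1] (g : E)
    (hg : g ^ m.1 = 1) : IsLocallyConstant (Completion.powHom m g hg) :=
  ((IsLocallyConstant.iff_continuous _).2 ((Completion.continuous_apply m).comp
    continuous_toAdd)).comp (fun z : ZMod m.1 => g ^ z.val)

theorem Completion.val_mod_eq (x : Completion S) (m m' : S) [NeZero m'.1] (h : m.1 ∣ m'.1) :
    (x.1 m).val = (x.1 m').val % m.1 := by
  rw [← x.2 m m' h, ZMod.castHom_apply, ZMod.cast_eq_val, ZMod.val_natCast]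

end Completion

/-! ### Topology, generators and universal property of the tame group. -/

section TameGroup

variable {q : ℕ}

instance neZero_zHat (m : {m : ℕ | 0 < m}) : NeZero m.1 := ⟨m.2.ne'⟩

instance neZero_zHatPrime (m : {m : ℕ | 0 < m ∧ m.Coprime q}) : NeZero m.1 := ⟨m.2.1.ne'⟩

/-- The homeomorphism from the tame group to the product. -/
def tameHomeomorph (q : ℕ) :
    TameGroup q ≃ₜ Multiplicative (ZHatPrime q) × Multiplicative ZHat :=
  SemidirectProduct.equivProd.toHomeomorphOfIsInducing ⟨rfl⟩

instance tameGroup_t2Space : T2Space (TameGroup q) := (tameHomeomorph q).symm.t2Space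

instance tameGroup_compactSpace : CompactSpace (TameGroup q) := (tameHomeomorph q).symm.compactSpace

instance tameGroup_totallyDisconnectedSpace : TotallyDisconnectedSpace (TameGroup q) where
  isTotallyDisconnected_univ := by
    have hc : Continuous fun g : TameGroup q =>
        ((Multiplicative.toAdd g.left).1, (Multiplicative.toAdd g.right).1) :=
      ((continuous_subtype_val.comp continuous_toAdd).prodMap
        (continuous_subtype_val.comp continuous_toAdd)).comp (tameHomeomorph q).continuous
    refine isTotallyDisconnected_of_image hc.continuousOn (fun g h hgh => ?_)
      (isTotallyDisconnected_of_totallyDisconnectedSpace _)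
    rw [Prod.mk.injEq] at hgh
    exact SemidirectProduct.ext (Subtype.ext hgh.1) (Subtype.ext hgh.2)

theorem continuous_left : Continuous fun g : TameGroup q => g.left :=
  continuous_fst.comp (tameHomeomorph q).continuous

theorem continuous_right : Continuous fun g : TameGroup q => g.right :=
  continuous_snd.comp (tameHomeomorph q).continuous

theorem continuous_tameGroup_mk {X : Type*} [TopologicalSpace X]
    {x : X → Multiplicative (ZHatPrime q)} {u : X → Multiplicative ZHat} (hx : Continuous x)
    (hu : Continuous u) : Continuous fun i => (⟨x i, u i⟩ : TameGroup q) :=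
  (tameHomeomorph q).symm.continuous.comp (hx.prodMk hu)

theorem continuous_qPow (m : ℕ) (hm : 0 < m) (h : m.Coprime q) :
    Continuous fun u => (qPow q m hm h u : ZMod m) := by
  have h1 := Completion.continuous_apply
    (⟨m.totient, Nat.totient_pos.2 hm⟩ : {m : ℕ | 0 < m})
  exact (continuous_of_discreteTopology (f := fun z : ZMod m.totient =>
    ((ZMod.unitOfCoprime q h.symm ^ z.val : (ZMod m)ˣ) : ZMod m))).comp
      (h1.comp continuous_toAdd)

theorem continuous_conjAction {X : Type*} [TopologicalSpace X]
    {x : X → Multiplicative (ZHatPrime q)} {u : X → Multiplicative ZHat} (hx : Continuous x)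
    (hu : Continuous u) : Continuous fun i => conjAction q (u i) (x i) := by
  refine continuous_ofAdd.comp (Continuous.subtype_mk (continuous_pi fun m => ?_) _)
  exact ((continuous_qPow m.1 m.2.1 m.2.2).comp hu).mul
    ((Completion.continuous_apply m).comp (continuous_toAdd.comp hx))

instance tameGroup_isTopologicalGroup : IsTopologicalGroup (TameGroup q) where
  continuous_mul := continuous_tameGroup_mk
    ((continuous_left.comp continuous_fst).mul (continuous_conjAction
      (continuous_left.comp continuous_snd) (continuous_right.comp continuous_fst)))
    ((continuous_right.comp continuous_fst).mul (continuous_right.comp continuous_snd))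
  continuous_inv := continuous_tameGroup_mk
    (continuous_conjAction continuous_left.inv continuous_right.inv) continuous_right.inv

theorem continuous_inl : Continuous (SemidirectProduct.inl (φ := conjAction q)) :=
  continuous_tameGroup_mk continuous_id continuous_const

theorem continuous_inr : Continuous (SemidirectProduct.inr (φ := conjAction q)) :=
  continuous_tameGroup_mk continuous_const continuous_id

/-- On `Ẑ'` a locally constant homomorphism factors through some `ℤ/m` with `m` prime to `q`. This
later gives the coprimality needed for the universal property. -/
theorem exists_map_tameT_pow_eq_one {E : Type*} [Group E] {φ : TameGroup q →* E}
    (hφ : IsLocallyConstant φ) : ∃ m, 0 < m ∧ m.Coprime q ∧ φ (tameT q) ^ m = 1 := by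
  obtain ⟨m, hm⟩ := Completion.exists_forall_map_eq_pow (S := {m : ℕ | 0 < m ∧ m.Coprime q})
    (by simp) (fun a ha b hb => ⟨Nat.mul_pos ha.1 hb.1, ha.2.mul_left hb.2⟩) (fun m hm => hm.1)
    (φ := φ.comp SemidirectProduct.inl) (hφ.comp_continuous continuous_inl)
  exact ⟨m, m.2.1, m.2.2, Completion.map_one_pow_eq_one hm⟩

/-- The elements `s` and `t` generate the tame group topologically. -/
theorem tameGroup_hom_ext {E : Type*} [Group E] {φ ψ : TameGroup q →* E}
    (hφ : IsLocallyConstant φ) (hψ : IsLocallyConstant ψ) (hs : φ (tameS q) = ψ (tameS q))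
    (ht : φ (tameT q) = ψ (tameT q)) : φ = ψ := by
  -- Working with the pair makes one modulus serve both homomorphisms.
  have h : IsLocallyConstant (φ.prod ψ) := hφ.prodMk hψ
  refine SemidirectProduct.hom_ext ?_ ?_
  · obtain ⟨m, hm⟩ := Completion.exists_forall_map_eq_pow (S := {m : ℕ | 0 < m ∧ m.Coprime q})
      (by simp) (fun a ha b hb => ⟨Nat.mul_pos ha.1 hb.1, ha.2.mul_left hb.2⟩) (fun m hm => hm.1)
      (φ := (φ.prod ψ).comp SemidirectProduct.inl) (h.comp_continuous continuous_inl)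
    refine MonoidHom.ext fun x => ?_
    have h1 := hm (Multiplicative.toAdd x)
    exact (congrArg Prod.fst h1).trans ((congrArg (· ^ _) ht).trans (congrArg Prod.snd h1).symm)
  · obtain ⟨m, hm⟩ := Completion.exists_forall_map_eq_pow (S := {m : ℕ | 0 < m})
      (by simp) (fun a ha b hb => Nat.mul_pos ha hb) (fun m hm => hm)
      (φ := (φ.prod ψ).comp SemidirectProduct.inr) (h.comp_continuous continuous_inr)
    refine MonoidHom.ext fun x => ?_
    have h1 := hm (Multiplicative.toAdd x)
    exact (congrArg Prod.fst h1).trans ((congrArg (· ^ _) hs).trans (congrArg Prod.snd h1).symm)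

theorem conj_pow_eq_pow_pow {E : Type*} [Group E] {S T : E} (h : S * T * S⁻¹ = T ^ q) (k : ℕ) :
    S ^ k * T * (S ^ k)⁻¹ = T ^ q ^ k := by
  induction k with
  | zero => simp
  | succ k ih =>
    rw [pow_succ', mul_inv_rev, show S * S ^ k * T * ((S ^ k)⁻¹ * S⁻¹) =
      S * (S ^ k * T * (S ^ k)⁻¹) * S⁻¹ by group, ih, ← conj_pow, h, ← pow_mul, pow_succ']

/-- The universal property of the tame group. -/
theorem exists_tameGroup_hom {E : Type*} [Group E] [Finite E] {S T : E}
    (h : S * T * S⁻¹ = T ^ q) (hT : (orderOf T).Coprime q) :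
    ∃ φ : TameGroup q →* E, IsLocallyConstant φ ∧ φ (tameS q) = S ∧ φ (tameT q) = T := by
  have hTpos := orderOf_pos T
  let m : {m : ℕ | 0 < m ∧ m.Coprime q} := ⟨orderOf T, hTpos, hT⟩
  let d : {m : ℕ | 0 < m} := ⟨(orderOf T).totient, Nat.totient_pos.2 hTpos⟩
  -- `N` must kill `S` and be a multiple of the totient of `orderOf T`, the modulus through which `q
  -- ^ u` is defined on `ℤ/orderOf T`.
  let N : {m : ℕ | 0 < m} :=
    ⟨orderOf S * (orderOf T).totient, Nat.mul_pos (orderOf_pos S) (Nat.totient_pos.2 hTpos)⟩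
  have hS : S ^ N.1 = 1 := by rw [pow_mul, pow_orderOf_eq_one, one_pow]
  have : NeZero m.1 := ⟨m.2.1.ne'⟩
  have : NeZero N.1 := ⟨N.2.ne'⟩
  have : NeZero (orderOf T) := ⟨hTpos.ne'⟩
  let φ : TameGroup q →* E := SemidirectProduct.lift
    (Completion.powHom m T (pow_orderOf_eq_one T)) (Completion.powHom N S hS) (by
      intro u
      ext x
      obtain ⟨x, rfl⟩ := Multiplicative.ofAdd.surjective x
      obtain ⟨u, rfl⟩ := Multiplicative.ofAdd.surjective u
      change T ^ ((ZMod.unitOfCoprime q hT.symm ^ (u.1 d).val : (ZMod (orderOf T))ˣ) *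
        x.1 m : ZMod (orderOf T)).val = S ^ (u.1 N).val * T ^ (x.1 m).val * (S ^ (u.1 N).val)⁻¹
      rw [← conj_pow, conj_pow_eq_pow_pow h, ← pow_mul, pow_eq_pow_iff_modEq,
        ← ZMod.natCast_eq_natCast_iff, ZMod.natCast_val, ZMod.cast_id, Nat.cast_mul,
        ZMod.natCast_val, ZMod.cast_id]
      congr 1
      rw [Completion.val_mod_eq u d N (Dvd.intro_left _ rfl),
        ← pow_eq_pow_mod _ (ZMod.pow_totient _), Units.val_pow_eq_pow_val,
        ZMod.coe_unitOfCoprime, Nat.cast_pow])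
  refine ⟨φ, ?_, ?_, ?_⟩
  · exact IsLocallyConstant.mul
      ((Completion.isLocallyConstant_powHom _ _ _).comp_continuous continuous_left)
      ((Completion.isLocallyConstant_powHom _ _ _).comp_continuous continuous_right)
  · exact (SemidirectProduct.lift_inr _ _ _ _).trans (Completion.powHom_one _ _ _)
  · exact (SemidirectProduct.lift_inl _ _ _ _).trans (Completion.powHom_one _ _ _)

end TameGroup

/-! ### The group extension attached to a normalized 2-cocycle. -/

section CocycleExtension

variable {F : Type*} [Field F] {Γ : Type*} [Group Γ]

/-- The extension of `Γ` by the one-dimensional representation `χ` that belongs to a normalized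
2-cocycle. -/
@[ext]
structure CocycleExtension (χ : Γ →* Fˣ) (c : Γ × Γ → F)
    (hc : ∀ f g h, (χ f : F) * c (g, h) - c (f * g, h) + c (f, g * h) - c (f, g) = 0)
    (hn : IsNormalized c) where
  /-- The component in the kernel. -/
  fst : F
  /-- The component in the quotient. -/
  snd : Γ

namespace CocycleExtension

variable {χ : Γ →* Fˣ} {c : Γ × Γ → F}
  {hc : ∀ f g h, (χ f : F) * c (g, h) - c (f * g, h) + c (f, g * h) - c (f, g) = 0}
  {hn : IsNormalized c}

instance : Mul (CocycleExtension χ c hc hn) :=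
  ⟨fun x y => ⟨x.fst + χ x.snd * y.fst + c (x.snd, y.snd), x.snd * y.snd⟩⟩

instance : One (CocycleExtension χ c hc hn) := ⟨⟨0, 1⟩⟩

instance : Inv (CocycleExtension χ c hc hn) :=
  ⟨fun x => ⟨-(χ x.snd⁻¹ * x.fst) - c (x.snd⁻¹, x.snd), x.snd⁻¹⟩⟩

theorem mul_def (x y : CocycleExtension χ c hc hn) :
    x * y = ⟨x.fst + χ x.snd * y.fst + c (x.snd, y.snd), x.snd * y.snd⟩ := rfl

theorem one_def : (1 : CocycleExtension χ c hc hn) = ⟨0, 1⟩ := rfl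

theorem inv_def (x : CocycleExtension χ c hc hn) :
    x⁻¹ = ⟨-(χ x.snd⁻¹ * x.fst) - c (x.snd⁻¹, x.snd), x.snd⁻¹⟩ := rfl

/-- Associativity is the cocycle identity; normalization makes `(0, 1)` a unit. -/
instance : Group (CocycleExtension χ c hc hn) :=
  Group.ofLeftAxioms
    (fun x y z => by
      ext
      · simp only [mul_def, map_mul, Units.val_mul]
        linear_combination -hc x.snd y.snd z.snd
      · exact mul_assoc _ _ _)
    (fun x => by
      ext
      · simp [mul_def, one_def, (hn _).1]
      · exact one_mul _)
    (fun x => by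
      ext
      · simp only [mul_def, one_def, inv_def]
        ring
      · exact inv_mul_cancel _)

instance [Finite F] [Finite Γ] : Finite (CocycleExtension χ c hc hn) :=
  Finite.of_injective (fun x => (x.fst, x.snd)) fun x y h => by
    rw [Prod.mk.injEq] at h
    exact CocycleExtension.ext h.1 h.2

/-- The projection to the quotient. -/
def sndHom : CocycleExtension χ c hc hn →* Γ where
  toFun := snd
  map_one' := rfl
  map_mul' _ _ := rfl

/-- The inclusion of the kernel. -/
def incl : Multiplicative F →* CocycleExtension χ c hc hn where
  toFun a := ⟨Multiplicative.toAdd a, 1⟩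
  map_one' := rfl
  map_mul' a b := by
    ext
    · simp [mul_def, (hn _).1]
    · exact (one_mul 1).symm

/-- The element of the kernel given by a scalar. -/
def ofScalar (a : F) : CocycleExtension χ c hc hn := incl (Multiplicative.ofAdd a)

theorem ofScalar_add (a b : F) :
    (ofScalar (a + b) : CocycleExtension χ c hc hn) = ofScalar a * ofScalar b :=
  map_mul incl _ _

theorem ofScalar_zero : (ofScalar 0 : CocycleExtension χ c hc hn) = 1 := rfl

theorem ofScalar_pow (a : F) (n : ℕ) :
    (ofScalar a : CocycleExtension χ c hc hn) ^ n = ofScalar (n * a) := by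
  rw [ofScalar, ← map_pow, ← ofAdd_nsmul, nsmul_eq_mul]
  rfl

theorem ofScalar_injective :
    Function.Injective (ofScalar : F → CocycleExtension χ c hc hn) := fun _ _ h =>
  congrArg fst h

theorem ofScalar_mul (a : F) (x : CocycleExtension χ c hc hn) :
    ofScalar a * x = ⟨a + x.fst, x.snd⟩ := by
  ext
  · simp [mul_def, ofScalar, incl, (hn _).1]
  · exact one_mul _

theorem mul_ofScalar (a : F) (x : CocycleExtension χ c hc hn) :
    x * ofScalar a = ofScalar (χ x.snd * a) * x := by
  rw [ofScalar_mul]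
  ext
  · simp [mul_def, ofScalar, incl, (hn _).2, add_comm]
  · exact mul_one _

theorem exists_eq_ofScalar_mul {x y : CocycleExtension χ c hc hn} (h : x.snd = y.snd) :
    ∃ a, x = ofScalar a * y :=
  ⟨x.fst - y.fst, by rw [ofScalar_mul, ← h, sub_add_cancel]⟩

theorem commute_ofScalar (a : F) {x : CocycleExtension χ c hc hn} (h : χ x.snd = 1) :
    Commute (ofScalar a) x := by
  rw [Commute, SemiconjBy, mul_ofScalar, h, Units.val_one, one_mul]

/-- Source of the sum over `[t ^ i, t]`: each further factor `(0, t)` contributes one term. -/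
theorem lift_pow_succ (t : Γ) (k : ℕ) :
    (⟨0, t⟩ : CocycleExtension χ c hc hn) ^ (k + 1) =
      ⟨∑ i ∈ Finset.Icc 1 k, c (t ^ i, t), t ^ (k + 1)⟩ := by
  induction k with
  | zero => simp
  | succ k ih =>
    rw [pow_succ, ih, mul_def, Finset.sum_Icc_succ_top (by omega)]
    simp [pow_succ]

/-- One more conjugation by `S` multiplies the accumulated scalar by `q`, and turns `T ^ q ^ (k +
1)` into `(d T ^ q) ^ q ^ (k + 1)`, which adds `q ^ (k + 1) d`. -/
theorem conj_lift_pow {S T : CocycleExtension χ c hc hn} {q : ℕ} {d : F} (hT : χ T.snd = 1)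
    (hS : (χ S.snd : F) = q) (h : S * T * S⁻¹ = ofScalar d * T ^ q) (k : ℕ) :
    S ^ (k + 1) * T * (S ^ (k + 1))⁻¹ = ofScalar ((k + 1) * q ^ k * d) * T ^ q ^ (k + 1) := by
  induction k with
  | zero => simpa using h
  | succ k ih =>
    have hc' : Commute (ofScalar d) (T ^ q) := (commute_ofScalar d hT).pow_right q
    rw [pow_succ' S, mul_inv_rev, show S * S ^ (k + 1) * T * ((S ^ (k + 1))⁻¹ * S⁻¹) =
      S * (S ^ (k + 1) * T * (S ^ (k + 1))⁻¹) * S⁻¹ by group, ih, ← mul_assoc, mul_ofScalar,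
      mul_assoc _ S, mul_assoc, ← conj_pow, h, hc'.mul_pow, ofScalar_pow, ← mul_assoc,
      ← ofScalar_add, ← pow_mul, hS, ← pow_succ']
    congr 2
    push_cast
    ring

/-- The relation of the tame group lifts to the extension if the obstruction vanishes. -/
theorem conj_lift_eq_pow {ℓ : ℕ} [hℓ : Fact ℓ.Prime] [CharP F ℓ] {q : ℕ} (hq : (q : F) ≠ 0)
    {s t : Γ} (hst : s * t * s⁻¹ = t ^ q) (ht : χ t = 1) (hs : (χ s : F) = q)
    (h0 : ∑ i ∈ Finset.Icc 1 (q ^ (ℓ - 1) - 1), c (t ^ i, t) + c (t ^ q ^ (ℓ - 1), s ^ (ℓ - 1))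
      - c (s ^ (ℓ - 1), t) = 0) :
    (⟨0, s⟩ * ⟨0, t⟩ * ⟨0, s⟩⁻¹ : CocycleExtension χ c hc hn) = ⟨0, t⟩ ^ q := by
  set S : CocycleExtension χ c hc hn := ⟨0, s⟩ with hS
  set T : CocycleExtension χ c hc hn := ⟨0, t⟩ with hT
  -- `d` is the obstruction; the goal is `d = 0`.
  obtain ⟨d, hd⟩ := exists_eq_ofScalar_mul (x := S * T * S⁻¹) (y := T ^ q) (by
    change sndHom (S * T * S⁻¹) = sndHom (T ^ q)
    rw [map_pow]
    exact hst)
  obtain ⟨k, hk⟩ : ∃ k, ℓ = k + 2 := ⟨ℓ - 2, by have := hℓ.out.two_le; omega⟩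
  have hk1 : ℓ - 1 = k + 1 := by omega
  rw [hk1] at h0
  have hconj := conj_lift_pow ht hs hd k
  let S' : CocycleExtension χ c hc hn := ⟨0, s ^ (k + 1)⟩
  obtain ⟨f, hf⟩ := exists_eq_ofScalar_mul (x := S') (y := S ^ (k + 1)) (by
    change _ = sndHom (S ^ (k + 1))
    rw [map_pow]
    rfl)
  have hst' := conj_pow_eq_pow_pow hst (k + 1)
  -- Two lifts of `s ^ (ℓ - 1)` differ by a scalar, and conjugation by a scalar fixes every element
  -- on which `χ` is trivial.
  have h1 : S' * T * S'⁻¹ = S ^ (k + 1) * T * (S ^ (k + 1))⁻¹ := by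
    have hcomm : Commute (ofScalar f) (S ^ (k + 1) * T * (S ^ (k + 1))⁻¹) := by
      apply commute_ofScalar
      change χ (sndHom (S ^ (k + 1) * T * (S ^ (k + 1))⁻¹)) = 1
      rw [map_mul, map_mul, map_inv, map_mul, map_mul, map_inv,
        show χ (sndHom T) = 1 from ht, mul_one, mul_inv_cancel]
    rw [hf, show ofScalar f * S ^ (k + 1) * T * (ofScalar f * S ^ (k + 1))⁻¹ =
      ofScalar f * (S ^ (k + 1) * T * (S ^ (k + 1))⁻¹) * (ofScalar f)⁻¹ by group, hcomm.eq,
      mul_inv_cancel_right]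
  have hQ : 0 < q ^ (k + 1) := Nat.pow_pos (Nat.pos_of_ne_zero (by rintro rfl; simp at hq))
  -- The difference of the first coordinates is exactly the sum in `h0`.
  have h2 : T ^ q ^ (k + 1) * S' = S' * T := by
    obtain ⟨m, hm⟩ : ∃ m, q ^ (k + 1) = m + 1 := ⟨q ^ (k + 1) - 1, by omega⟩
    rw [hm, lift_pow_succ]
    rw [hm, Nat.add_sub_cancel] at h0
    rw [hm] at hst'
    ext
    · simp only [mul_def, S', hT, mul_zero, add_zero, zero_add]
      exact sub_eq_zero.1 h0
    · change t ^ (m + 1) * s ^ (k + 1) = s ^ (k + 1) * t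
      rw [← hst', inv_mul_cancel_right]
  rw [← h2, mul_inv_cancel_right, hconj] at h1
  have h3 : ((k : F) + 1) * q ^ k * d = 0 := by
    apply ofScalar_injective (hc := hc) (hn := hn)
    rw [ofScalar_zero]
    exact right_eq_mul.1 h1
  -- `k + 1 = ℓ - 1`, which is `-1` in `F`.
  have hk' : ((k : F) + 1) ≠ 0 := by
    have h4 : ((ℓ : ℕ) : F) = 0 := CharP.cast_eq_zero F ℓ
    rw [hk] at h4
    intro h5
    apply one_ne_zero (α := F)
    push_cast at h4
    linear_combination h4 - h5
  have hd0 : d = 0 := by simpa [hk', hq] using h3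
  rw [hd, hd0, ofScalar_zero, one_mul]

end CocycleExtension

end CocycleExtension

/-! ### Normalization and reduction to a finite quotient. -/

section Factor

variable {F : Type*} [Field F] {G : Type*} [Group G] [TopologicalSpace G]

omit [TopologicalSpace G] in
theorem charRep_apply (χ : G →* Fˣ) (g : G) (m : F) : charRep χ g m = (χ g : F) * m := rfl

theorem isDiscreteRep_charRep {χ : G →* Fˣ} (hχ : IsLocallyConstant χ) :
    IsDiscreteRep (charRep χ) := fun m => hχ.comp fun x : Fˣ => (x : F) * m

/-- Every class in `H²` is represented by a normalized 2-cocycle. -/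
theorem exists_isNormalized {χ : G →* Fˣ} (hχ : IsLocallyConstant χ) (x : H2 (charRep χ)) :
    ∃ c : Z2 (charRep χ), IsNormalized c.1 ∧ cls2 c = x := by
  obtain ⟨c, rfl⟩ := Submodule.mkQ_surjective _ x
  have h1 : ∀ g, c.1 (1, g) = c.1 (1, 1) := fun g => by
    have := c.2.2 1 1 g
    simp only [map_one, one_mul, Module.End.one_apply] at this
    linear_combination this
  have h2 : ∀ g, c.1 (g, 1) = χ g * c.1 (1, 1) := fun g => by
    have := c.2.2 g 1 1
    simp only [charRep_apply, mul_one] at this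
    linear_combination -this
  -- This is the coboundary of the constant cochain `c (1, 1)`.
  let d : Z2 (charRep χ) := ⟨fun y => χ y.1 * c.1 (1, 1),
    (isDiscreteRep_charRep hχ (c.1 (1, 1))).comp_continuous continuous_fst, fun f g h => by
      simp only [charRep_apply, map_mul, Units.val_mul]
      ring⟩
  refine ⟨c - d, fun g => ⟨?_, ?_⟩, (Submodule.Quotient.eq _).2
    ⟨fun _ => -c.1 (1, 1), IsLocallyConstant.const _, fun f g => ?_⟩⟩
  · change c.1 (1, g) - χ 1 * c.1 (1, 1) = 0
    rw [h1, map_one, Units.val_one, one_mul, sub_self]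
  · change c.1 (g, 1) - χ g * c.1 (1, 1) = 0
    rw [h2, sub_self]
  · change c.1 (f, g) - χ f * c.1 (1, 1) - c.1 (f, g) = χ f * -c.1 (1, 1) - -c.1 (1, 1) + -c.1 (1, 1)
    ring

/-- A continuous 2-cocycle on a profinite group comes from a finite quotient. -/
theorem exists_factor_quotient [IsTopologicalGroup G] [CompactSpace G]
    [TotallyDisconnectedSpace G] {χ : G →* Fˣ} (hχ : IsLocallyConstant χ) (c : Z2 (charRep χ)) :
    ∃ (U : OpenNormalSubgroup G) (χ' : G ⧸ U.toSubgroup →* Fˣ)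
      (c' : (G ⧸ U.toSubgroup) × (G ⧸ U.toSubgroup) → F),
      (∀ g : G, χ' g = χ g) ∧ ∀ g h : G, c' (g, h) = c.1 (g, h) := by
  -- Pairing the cocycle with `χ` yields one subgroup through which both factor.
  obtain ⟨U, hU⟩ := exists_openNormalSubgroup_forall_mul_eq
    (c.2.1.prodMk (hχ.comp_continuous continuous_fst))
  refine ⟨U, QuotientGroup.lift _ χ fun u hu => ?_,
    fun x => Quotient.liftOn₂ x.1 x.2 (fun g h => c.1 (g, h)) fun g h g' h' hg hh => ?_,
    fun _ => rfl, fun _ _ => rfl⟩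
  · have := congrArg Prod.snd (hU 1 1 u hu 1 (one_mem U))
    simpa using this
  · have := congrArg Prod.fst (hU g h _ (QuotientGroup.leftRel_apply.1 hg) _
      (QuotientGroup.leftRel_apply.1 hh))
    simp only [mul_inv_cancel_left] at this
    exact this.symm

end Factor

/-! ### The isomorphism from `H²` of the tame group to `F`. -/

section TameClass

variable {F : Type*} [Field F] {ℓ q : ℕ} [hℓ : Fact ℓ.Prime] [CharP F ℓ] (hℓq : ℓ.Coprime q)

include hℓq in
theorem cast_ne_zero_of_coprime : (q : F) ≠ 0 := fun h =>
  (hℓ.out.coprime_iff_not_dvd.1 hℓq) ((CharP.cast_eq_zero_iff F ℓ q).1 h)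

include hℓq in
theorem cast_pow_sub_one : (q : F) ^ (ℓ - 1) = 1 := by
  have h := ZMod.pow_card_sub_one_eq_one (cast_ne_zero_of_coprime (F := ZMod ℓ) hℓq)
  have h1 := congrArg (ZMod.castHom (dvd_refl ℓ) F) h
  rwa [map_pow, map_natCast, map_one] at h1

theorem cyclotomic_tameT : cyclotomic F ℓ q hℓq (tameT q) = 1 := by
  simp [cyclotomic, tameT]

theorem tameT_pow_mul_tameS_pow (q k : ℕ) :
    tameT q ^ q ^ k * tameS q ^ k = tameS q ^ k * tameT q := by
  rw [← conj_pow_eq_pow_pow (tame_relation q), inv_mul_cancel_right]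

/-- The value of a 2-cocycle of the tame group on the relation of `t` and `s ^ (ℓ - 1)`. -/
noncomputable def tameForm (F : Type*) [Field F] (ℓ q : ℕ) [Fact ℓ.Prime] [CharP F ℓ] (hℓq : ℓ.Coprime q) :
    Z2 (charRep (cyclotomic F ℓ q hℓq)) →ₗ[F] F where
  toFun c := ∑ i ∈ Finset.Icc 1 (q ^ (ℓ - 1) - 1), c.1 (tameT q ^ i, tameT q)
    + c.1 (tameT q ^ q ^ (ℓ - 1), tameS q ^ (ℓ - 1)) - c.1 (tameS q ^ (ℓ - 1), tameT q)
  map_add' a b := by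
    simp only [Submodule.coe_add, Pi.add_apply, Finset.sum_add_distrib]
    ring
  map_smul' r a := by
    simp only [Submodule.coe_smul, Pi.smul_apply, smul_eq_mul, ← Finset.mul_sum, RingHom.id_apply]
    ring

theorem tameForm_apply (c : Z2 (charRep (cyclotomic F ℓ q hℓq))) :
    tameForm F ℓ q hℓq c = ∑ i ∈ Finset.Icc 1 (q ^ (ℓ - 1) - 1), c.1 (tameT q ^ i, tameT q)
      + c.1 (tameT q ^ q ^ (ℓ - 1), tameS q ^ (ℓ - 1)) - c.1 (tameS q ^ (ℓ - 1), tameT q) := rfl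

theorem tameForm_eq_zero_of_mem_B2 {c : Z2 (charRep (cyclotomic F ℓ q hℓq))}
    (hc : c.1 ∈ B2 (charRep (cyclotomic F ℓ q hℓq))) : tameForm F ℓ q hℓq c = 0 := by
  obtain ⟨b, -, hb⟩ := hc
  have hq := cast_ne_zero_of_coprime (F := F) hℓq
  have hQ : 0 < q ^ (ℓ - 1) := Nat.pow_pos (Nat.pos_of_ne_zero (by rintro rfl; simp at hq))
  -- Since `χ(t) = 1`, the coboundary terms `b(t ^ i) - b(t ^ (i + 1)) + b(t)` telescope.
  have hsum : ∀ k : ℕ, ∑ i ∈ Finset.Icc 1 k, c.1 (tameT q ^ i, tameT q) =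
      (k + 1) * b (tameT q) - b (tameT q ^ (k + 1)) := by
    intro k
    induction k with
    | zero => simp
    | succ k ih =>
      rw [Finset.sum_Icc_succ_top (by omega), ih, hb, charRep_apply, map_pow, cyclotomic_tameT]
      push_cast
      rw [pow_succ _ (k + 1)]
      simp only [one_pow, one_mul]
      ring
  have hQ' : ((q ^ (ℓ - 1) - 1 : ℕ) : F) + 1 = 1 := by
    rw [Nat.cast_pred hQ, sub_add_cancel, Nat.cast_pow, cast_pow_sub_one hℓq]
  rw [tameForm_apply, hsum, hb, hb, Nat.sub_add_cancel hQ, hQ', charRep_apply, charRep_apply,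
    map_pow, map_pow, cyclotomic_tameT, tameT_pow_mul_tameS_pow, Units.val_pow_eq_pow_val (cyclotomic F ℓ q hℓq _),
    cyclotomic_tameS, cast_pow_sub_one hℓq]
  simp only [one_pow, Units.val_one]
  ring

/-- A normalized 2-cocycle on which the form vanishes is a coboundary. -/
theorem mem_B2_of_tameForm_eq_zero [Finite F] {c : Z2 (charRep (cyclotomic F ℓ q hℓq))}
    (hn : IsNormalized c.1) (h0 : tameForm F ℓ q hℓq c = 0) :
    c.1 ∈ B2 (charRep (cyclotomic F ℓ q hℓq)) := by
  obtain ⟨U, χ, d, hχ, hd⟩ :=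
    exists_factor_quotient (cyclotomic_locallyConstant F ℓ q hℓq) c
  have hfin : Finite (TameGroup q ⧸ U.toSubgroup) :=
    Subgroup.quotient_finite_of_isOpen _ U.toOpenSubgroup.isOpen
  have hdc : ∀ f g h, (χ f : F) * d (g, h) - d (f * g, h) + d (f, g * h) - d (f, g) = 0 := by
    intro f g h
    induction f using QuotientGroup.induction_on
    induction g using QuotientGroup.induction_on
    induction h using QuotientGroup.induction_on
    rw [← QuotientGroup.mk_mul, ← QuotientGroup.mk_mul, hd, hd, hd, hd, hχ]
    exact c.2.2 _ _ _
  have hdn : IsNormalized d := by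
    intro g
    induction g using QuotientGroup.induction_on
    rw [← QuotientGroup.mk_one, hd, hd]
    exact hn _
  have hmk : IsLocallyConstant (QuotientGroup.mk' U.toSubgroup) :=
    isLocallyConstant_of_forall_mul_eq U.toOpenSubgroup.isOpen fun g u hu => by
      rw [map_mul, show QuotientGroup.mk' U.toSubgroup u = 1 from
        (QuotientGroup.eq_one_iff u).2 hu, mul_one]
  have ht : χ (tameT q : TameGroup q ⧸ U.toSubgroup) = 1 := by rw [hχ, cyclotomic_tameT]
  let S : CocycleExtension χ d hdc hdn := ⟨0, (tameS q : TameGroup q ⧸ U.toSubgroup)⟩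
  let T : CocycleExtension χ d hdc hdn := ⟨0, (tameT q : TameGroup q ⧸ U.toSubgroup)⟩
  have hST : S * T * S⁻¹ = T ^ q := by
    refine CocycleExtension.conj_lift_eq_pow (ℓ := ℓ) (cast_ne_zero_of_coprime hℓq)
      ?_ ht (by rw [hχ, cyclotomic_tameS]) ?_
    · rw [← QuotientGroup.mk_pow, ← tame_relation]
      rfl
    · simp only [← QuotientGroup.mk_pow, hd]
      exact h0
  -- Some `T ^ m` with `m` prime to `q` is a scalar, hence killed by `ℓ`, so the order of `T`
  -- divides `m * ℓ`.
  have hT : (orderOf T).Coprime q := by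
    obtain ⟨m, -, hm, htm⟩ := exists_map_tameT_pow_eq_one hmk
    obtain ⟨a, ha⟩ := CocycleExtension.exists_eq_ofScalar_mul (x := T ^ m) (y := 1) (by
      change CocycleExtension.sndHom (T ^ m) = 1
      rw [map_pow]
      exact htm)
    refine Nat.Coprime.coprime_dvd_left (orderOf_dvd_of_pow_eq_one (n := m * ℓ) ?_)
      (hm.mul_left hℓq)
    rw [pow_mul, ha, mul_one, CocycleExtension.ofScalar_pow, CharP.cast_eq_zero, zero_mul,
      CocycleExtension.ofScalar_zero]
  obtain ⟨φ, hφ, hφs, hφt⟩ := exists_tameGroup_hom hST hT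
  have hφ2 : CocycleExtension.sndHom.comp φ = QuotientGroup.mk' U.toSubgroup := by
    refine tameGroup_hom_ext (hφ.comp CocycleExtension.sndHom) hmk ?_ ?_
    · exact congrArg CocycleExtension.sndHom hφs
    · exact congrArg CocycleExtension.sndHom hφt
  have hφ2' : ∀ g, (φ g).snd = (g : TameGroup q ⧸ U.toSubgroup) := fun g =>
    DFunLike.congr_fun hφ2 g
  -- As `φ` lies over the quotient map, `b g = (φ g).fst` satisfies `b(fg) = b(f) + χ(f) b(g) + c(f,
  -- g)`, so `c` is the coboundary of `-b`.
  refine ⟨fun g => -(φ g).fst, hφ.comp fun x => -x.fst, fun f g => ?_⟩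
  simp only [charRep_apply, map_mul, CocycleExtension.mul_def, hφ2', hd, hχ]
  ring

/-- The 1-cocycle with values in `F(1)` that vanishes on `s` and is `1` on `t`. -/
noncomputable def tameCocycle (F : Type*) [Field F] (ℓ q : ℕ) [Fact ℓ.Prime] [CharP F ℓ]
    (hℓq : ℓ.Coprime q) (g : TameGroup q) : F :=
  ZMod.castHom (dvd_refl ℓ) F ((Multiplicative.toAdd g.left).1 ⟨ℓ, (Fact.out : ℓ.Prime).pos, hℓq⟩)

/-- The homomorphism to `F` that is `1` on `s` and vanishes on `t`. -/
noncomputable def tameHom (F : Type*) [Field F] (ℓ q : ℕ) [Fact ℓ.Prime] [CharP F ℓ] (g : TameGroup q) : F :=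
  ZMod.castHom (dvd_refl ℓ) F ((Multiplicative.toAdd g.right).1 ⟨ℓ, (Fact.out : ℓ.Prime).pos⟩)

theorem tameCocycle_mul (g h : TameGroup q) : tameCocycle F ℓ q hℓq (g * h) =
    tameCocycle F ℓ q hℓq g + cyclotomic F ℓ q hℓq g * tameCocycle F ℓ q hℓq h := by
  have : (Multiplicative.toAdd (g * h).left).1 ⟨ℓ, (Fact.out : ℓ.Prime).pos, hℓq⟩ =
    (Multiplicative.toAdd g.left).1 ⟨ℓ, (Fact.out : ℓ.Prime).pos, hℓq⟩ +
      (qPow q ℓ _ _ g.right : ZMod ℓ) *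
        (Multiplicative.toAdd h.left).1 ⟨ℓ, (Fact.out : ℓ.Prime).pos, hℓq⟩ := rfl
  rw [tameCocycle, this, map_add, map_mul]
  rfl

theorem tameHom_mul (g h : TameGroup q) :
    tameHom F ℓ q (g * h) = tameHom F ℓ q g + tameHom F ℓ q h :=
  map_add (ZMod.castHom (dvd_refl ℓ) F) _ _

theorem isLocallyConstant_tameCocycle : IsLocallyConstant (tameCocycle F ℓ q hℓq) :=
  ((IsLocallyConstant.iff_continuous _).2 ((Completion.continuous_apply
    (⟨ℓ, (Fact.out : ℓ.Prime).pos, hℓq⟩ : {m : ℕ | 0 < m ∧ m.Coprime q})).comp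
      (continuous_toAdd.comp continuous_left))).comp (ZMod.castHom (dvd_refl ℓ) F)

theorem isLocallyConstant_tameHom : IsLocallyConstant (tameHom F ℓ q) :=
  ((IsLocallyConstant.iff_continuous _).2 ((Completion.continuous_apply
    (⟨ℓ, (Fact.out : ℓ.Prime).pos⟩ : {m : ℕ | 0 < m})).comp
      (continuous_toAdd.comp continuous_right))).comp (ZMod.castHom (dvd_refl ℓ) F)

/-- On the cup product of `tameHom` with `tameCocycle` only the term `-[s ^ (ℓ - 1), t]` survives,
and it equals `-(ℓ - 1) = 1`. -/
theorem tameForm_surjective : Function.Surjective (tameForm F ℓ q hℓq) := by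
  have hχ := cyclotomic_locallyConstant F ℓ q hℓq
  let c : Z2 (charRep (cyclotomic F ℓ q hℓq)) :=
    ⟨fun x => tameHom F ℓ q x.1 * (cyclotomic F ℓ q hℓq x.1 * tameCocycle F ℓ q hℓq x.2),
    ((isLocallyConstant_tameHom.comp_continuous continuous_fst).mul
      ((isDiscreteRep_charRep hχ).locallyConstant continuous_fst
        ((isLocallyConstant_tameCocycle hℓq).comp_continuous continuous_snd))),
    fun f g h => by
      simp only [charRep_apply, tameHom_mul, tameCocycle_mul, map_mul, Units.val_mul]
      ring⟩
  have hT1 : tameHom F ℓ q (tameT q) = 0 := map_zero (ZMod.castHom (dvd_refl ℓ) F)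
  have hS1 : tameHom F ℓ q (tameS q) = 1 := map_one (ZMod.castHom (dvd_refl ℓ) F)
  have hT2 : tameCocycle F ℓ q hℓq (tameT q) = 1 := map_one (ZMod.castHom (dvd_refl ℓ) F)
  have h1 : tameHom F ℓ q 1 = 0 := map_zero (ZMod.castHom (dvd_refl ℓ) F)
  have hpow : ∀ (g : TameGroup q) (k : ℕ), tameHom F ℓ q (g ^ k) = k * tameHom F ℓ q g := by
    intro g k
    induction k with
    | zero => simpa using h1
    | succ k ih =>
      rw [pow_succ, tameHom_mul, ih]
      push_cast
      ring
  have hc : tameForm F ℓ q hℓq c = 1 := by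
    rw [tameForm_apply]
    simp only [c, hpow, hT1, hS1, hT2, mul_zero, zero_mul, Finset.sum_const_zero, map_pow,
      Units.val_pow_eq_pow_val, cyclotomic_tameS, cast_pow_sub_one hℓq]
    rw [Nat.cast_pred hℓ.out.pos, CharP.cast_eq_zero]
    ring
  exact fun a => ⟨a • c, by rw [map_smul, hc, smul_eq_mul, mul_one]⟩

/-- The isomorphism of `H²` of the tame group with the field. -/
noncomputable def tameEquiv (F : Type*) [Field F] [Finite F] (ℓ q : ℕ) [Fact ℓ.Prime] [CharP F ℓ]
    (hℓq : ℓ.Coprime q) : H2 (charRep (cyclotomic F ℓ q hℓq)) ≃ₗ[F] F :=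
  LinearEquiv.ofBijective
    (Submodule.liftQ _ (tameForm F ℓ q hℓq) fun _ hc => tameForm_eq_zero_of_mem_B2 hℓq hc) (by
      constructor
      · rw [injective_iff_map_eq_zero]
        intro x hx
        obtain ⟨c, hn, rfl⟩ := exists_isNormalized (cyclotomic_locallyConstant F ℓ q hℓq) x
        exact (Submodule.Quotient.mk_eq_zero _).2 (mem_B2_of_tameForm_eq_zero hℓq hn hx)
      · intro a
        obtain ⟨c, hc⟩ := tameForm_surjective hℓq a
        exact ⟨cls2 c, hc⟩)

theorem tameEquiv_cls2 [Finite F] (c : Z2 (charRep (cyclotomic F ℓ q hℓq))) :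
    tameEquiv F ℓ q hℓq (cls2 c) = tameForm F ℓ q hℓq c := rfl

end TameClass

/-! ### The form on cup products. -/

section CupProduct

variable {F : Type*} [Field F] {ℓ q : ℕ} [hℓ : Fact ℓ.Prime] [CharP F ℓ] (hℓq : ℓ.Coprime q)
  {M N : Type*} [AddCommGroup M] [Module F M] [AddCommGroup N] [Module F N]

theorem cocycle_tameT_pow {ρ : Representation F (TameGroup q) M} (ht : ρ (tameT q) = 1)
    (c : Z1 ρ) (k : ℕ) : c.1 (tameT q ^ k) = (k : F) • c.1 (tameT q) := by
  induction k with
  | zero =>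
    have h := c.2.2 1 1
    rw [mul_one, map_one, Module.End.one_apply] at h
    simpa using h
  | succ k ih =>
    rw [pow_succ', c.2.2, ht, Module.End.one_apply, ih, Nat.cast_succ, add_smul, one_smul,
      add_comm]

/-- If `t` acts trivially, then `s` acts on the value of a cocycle at `t` as multiplication by
`q`. -/
theorem apply_tameS_cocycle_tameT {ρ : Representation F (TameGroup q) M}
    (ht : ρ (tameT q) = 1) (c : Z1 ρ) :
    ρ (tameS q) (c.1 (tameT q)) = (q : F) • c.1 (tameT q) := by
  -- Expand the cocycle on both sides of `s t = t ^ q s`.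
  have h1 := c.2.2 (tameS q) (tameT q)
  have h2 := c.2.2 (tameT q ^ q) (tameS q)
  have h3 := tameT_pow_mul_tameS_pow q 1
  rw [pow_one, pow_one] at h3
  rw [h3, h1, map_pow, ht, one_pow, Module.End.one_apply, cocycle_tameT_pow ht, add_comm] at h2
  exact add_right_cancel h2

theorem apply_tameS_pow_cocycle_tameT {ρ : Representation F (TameGroup q) M}
    (ht : ρ (tameT q) = 1) (c : Z1 ρ) (k : ℕ) :
    ρ (tameS q ^ k) (c.1 (tameT q)) = (q : F) ^ k • c.1 (tameT q) := by
  induction k with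
  | zero => simp
  | succ k ih =>
    rw [pow_succ, map_mul, Module.End.mul_apply, apply_tameS_cocycle_tameT ht, map_smul, ih,
      smul_smul, pow_succ']

/-- The value of the form on a cup product. -/
theorem tameForm_cupZ {ρM : Representation F (TameGroup q) M}
    {ρN : Representation F (TameGroup q) N} (β : M →ₗ[F] N →ₗ[F] F)
    (hβ : ∀ g m n, β (ρM g m) (ρN g n) = charRep (cyclotomic F ℓ q hℓq) g (β m n))
    (hN : IsDiscreteRep ρN) (htM : ρM (tameT q) = 1) (htN : ρN (tameT q) = 1)
    (c₁ : Z1 ρM) (c₂ : Z1 ρN) :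
    tameForm F ℓ q hℓq (cupZ β hβ hN c₁ c₂) =
      ((∑ i ∈ Finset.range (q ^ (ℓ - 1)), i : ℕ) : F) * β (c₁.1 (tameT q)) (c₂.1 (tameT q)) +
        β (c₁.1 (tameS q)) (c₂.1 (tameT q)) - β (c₁.1 (tameT q)) (c₂.1 (tameS q)) := by
  have hq := cast_ne_zero_of_coprime (F := F) hℓq
  have hQ : 0 < q ^ (ℓ - 1) := Nat.pow_pos (Nat.pos_of_ne_zero (by rintro rfl; simp at hq))
  have hcup : ∀ f g, (cupZ β hβ hN c₁ c₂).1 (f, g) = β (c₁.1 f) (ρN f (c₂.1 g)) :=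
    fun _ _ => rfl
  -- `s` scales both `c₂(t)` and the values of `β` by `q`; cancelling `q` removes `s` from the other
  -- argument.
  have hA : ∀ X, β (ρM (tameS q) X) (c₂.1 (tameT q)) = β X (c₂.1 (tameT q)) := fun X => by
    have h := hβ (tameS q) X (c₂.1 (tameT q))
    rw [apply_tameS_cocycle_tameT htN, map_smul, charRep_apply, cyclotomic_tameS,
      smul_eq_mul] at h
    exact mul_left_cancel₀ hq h
  have hB : ∀ Y, β (c₁.1 (tameT q)) (ρN (tameS q) Y) = β (c₁.1 (tameT q)) Y := fun Y => by
    have h := hβ (tameS q) (c₁.1 (tameT q)) Y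
    rw [apply_tameS_cocycle_tameT htM, map_smul, LinearMap.smul_apply, charRep_apply,
      cyclotomic_tameS, smul_eq_mul] at h
    exact mul_left_cancel₀ hq h
  have hzero₁ : c₁.1 1 = 0 := by simpa using cocycle_tameT_pow htM c₁ 0
  have hzero₂ : c₂.1 1 = 0 := by simpa using cocycle_tameT_pow htN c₂ 0
  have hA' : ∀ k : ℕ, β (c₁.1 (tameS q ^ k)) (c₂.1 (tameT q)) =
      k * β (c₁.1 (tameS q)) (c₂.1 (tameT q)) := fun k => by
    induction k with
    | zero => simp [hzero₁]
    | succ k ih =>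
      rw [pow_succ', c₁.2.2, map_add, LinearMap.add_apply, hA, ih]
      push_cast
      ring
  have hB' : ∀ k : ℕ, β (c₁.1 (tameT q)) (c₂.1 (tameS q ^ k)) =
      k * β (c₁.1 (tameT q)) (c₂.1 (tameS q)) := fun k => by
    induction k with
    | zero => simp [hzero₂]
    | succ k ih =>
      rw [pow_succ', c₂.2.2, map_add, hB, ih]
      push_cast
      ring
  have hsum : ∑ i ∈ Finset.Icc 1 (q ^ (ℓ - 1) - 1), ((i : ℕ) : F) =
      ((∑ i ∈ Finset.range (q ^ (ℓ - 1)), i : ℕ) : F) := by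
    rw [Nat.cast_sum, Finset.range_eq_Ico, Finset.sum_eq_sum_Ico_succ_bot hQ, Nat.cast_zero,
      zero_add]
    congr 1
  rw [tameForm_apply]
  -- `q ^ (ℓ - 1) = 1` and `ℓ - 1 = -1` in `F` give the signs of the mixed terms.
  simp only [hcup, map_pow ρN (tameT q), htN, one_pow, Module.End.one_apply,
    cocycle_tameT_pow htM, map_smul, LinearMap.smul_apply, smul_eq_mul, ← Finset.sum_mul, hsum,
    apply_tameS_pow_cocycle_tameT htN, hA', hB', Nat.cast_pow, cast_pow_sub_one hℓq,
    Nat.cast_pred hℓ.out.pos, CharP.cast_eq_zero]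
  ring

include hℓq in
-- The sum is `Q (Q - 1) / 2` with `Q = q ^ (ℓ - 1) ≡ 1 mod ℓ`. For odd `ℓ` the `2` is invertible;
-- for `ℓ = 2`, `Q = q ≡ 1 mod 4` makes it even.
theorem cast_sum_range_eq_zero (h : ¬(ℓ = 2 ∧ q ≡ 3 [MOD 4])) :
    ((∑ i ∈ Finset.range (q ^ (ℓ - 1)), i : ℕ) : F) = 0 := by
  have hsum := Finset.sum_range_id_mul_two (q ^ (ℓ - 1))
  by_cases h2 : ℓ = 2
  · subst h2
    have hq : q % 4 = 1 := by
      have h1 : q % 4 ≠ 3 := fun h3 => h ⟨rfl, h3⟩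
      have h4 := Nat.odd_iff.1 (Nat.coprime_two_left.1 hℓq)
      omega
    obtain ⟨m, rfl⟩ : ∃ m, q = 4 * m + 1 := ⟨q / 4, by omega⟩
    rw [CharP.cast_eq_zero_iff F 2]
    refine ⟨(4 * m + 1) * m, mul_right_cancel₀ two_ne_zero (hsum.trans ?_)⟩
    simp only [Nat.add_one_sub_one, pow_one]
    ring
  · have hQ : 0 < q ^ (ℓ - 1) := Nat.pow_pos (Nat.pos_of_ne_zero (by
      rintro rfl
      exact hℓ.out.one_lt.ne' ((Nat.coprime_zero_right ℓ).1 hℓq)))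
    have hF := congrArg (Nat.cast : ℕ → F) hsum
    rw [Nat.cast_mul, Nat.cast_mul, Nat.cast_pred hQ, Nat.cast_pow, cast_pow_sub_one hℓq,
      sub_self, mul_zero] at hF
    refine (mul_eq_zero.1 hF).resolve_right fun h3 => h2 ?_
    exact (Nat.prime_dvd_prime_iff_eq hℓ.out Nat.prime_two).1 ((CharP.cast_eq_zero_iff F ℓ 2).1 h3)

theorem cast_sum_range_eq_one [CharP F 2] (h : q ≡ 3 [MOD 4]) :
    ((∑ i ∈ Finset.range (q ^ (2 - 1)), i : ℕ) : F) = 1 := by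
  have hsum := Finset.sum_range_id_mul_two (q ^ (2 - 1))
  have hq : q % 4 = 3 := h
  obtain ⟨m, rfl⟩ : ∃ m, q = 4 * m + 3 := ⟨q / 4, by omega⟩
  have h1 : ∑ i ∈ Finset.range ((4 * m + 3) ^ (2 - 1)), i = 2 * (4 * m * m + 5 * m + 1) + 1 := by
    refine mul_right_cancel₀ two_ne_zero (hsum.trans ?_)
    rw [show (4 * m + 3) ^ (2 - 1) = 4 * m + 2 + 1 by simp, Nat.add_sub_cancel]
    ring
  rw [h1, Nat.cast_succ, Nat.cast_mul, CharP.cast_eq_zero, zero_mul, zero_add]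

end CupProduct

/-! ### The trace pairing and its compatibility with inflation. -/

section TracePairing

variable {F : Type*} [Field F] {ℓ q : ℕ} [hℓ : Fact ℓ.Prime] [CharP F ℓ]
  (hℓq : ℓ.Coprime q) {n : ℕ}

theorem ad0_tameT {r : TameGroup q →* GL (Fin n) F} (ht : r (tameT q) = 1) :
    ad0 r (tameT q) = 1 := by
  ext1 A
  ext1
  change (r (tameT q)).1 * A.1 * (r (tameT q))⁻¹.1 = A.1
  simp [ht]

theorem twist_ad0_tameT {r : TameGroup q →* GL (Fin n) F} (ht : r (tameT q) = 1) :
    twist (cyclotomic F ℓ q hℓq) (ad0 r) (tameT q) = 1 := by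
  change ((cyclotomic F ℓ q hℓq (tameT q) : Fˣ) : F) • ad0 r (tameT q) = 1
  rw [cyclotomic_tameT, ad0_tameT ht, Units.val_one, one_smul]

theorem tameEquiv_tracePairing [Finite F] {r : TameGroup q →* GL (Fin n) F} (hr : IsLocallyConstant r)
    (ht : r (tameT q) = 1) (c₁ : Z1 (ad0 r)) (c₂ : Z1 (twist (cyclotomic F ℓ q hℓq) (ad0 r))) :
    tameEquiv F ℓ q hℓq (tracePairing r hr (cyclotomic F ℓ q hℓq)
      (cyclotomic_locallyConstant F ℓ q hℓq) (cls1 c₁) (cls1 c₂)) =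
      ((∑ i ∈ Finset.range (q ^ (ℓ - 1)), i : ℕ) : F) *
          Matrix.trace ((c₁.1 (tameT q)).1 * (c₂.1 (tameT q)).1) +
        Matrix.trace ((c₁.1 (tameS q)).1 * (c₂.1 (tameT q)).1) -
        Matrix.trace ((c₂.1 (tameS q)).1 * (c₁.1 (tameT q)).1) := by
  rw [tracePairing, cupH_mk, tameEquiv_cls2,
    tameForm_cupZ hℓq _ _ _ (ad0_tameT ht) (twist_ad0_tameT hℓq ht),
    Matrix.trace_mul_comm (c₂.1 (tameS q)).1]
  rfl

end TracePairing

/-- Cup product and pullback already commute on cocycles, so representatives suffice. -/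
theorem tracePairing_inflH1 {F : Type*} [Field F] {G H : Type*} [Group G] [TopologicalSpace G]
    [Group H] [TopologicalSpace H] (π : G →ₜ* H) {n : ℕ} (r : H →* GL (Fin n) F)
    (hr : IsLocallyConstant r) (χ : H →* Fˣ) (hχ : IsLocallyConstant χ)
    (x : H1 (ad0 r)) (y : H1 (twist χ (ad0 r))) :
    tracePairing (r.comp π.toMonoidHom) (hr.comp_continuous π.continuous_toFun)
        (χ.comp π.toMonoidHom) (hχ.comp_continuous π.continuous_toFun)
        (inflH1 (ad0 r) (ad0 (r.comp π.toMonoidHom)) π (fun _ => rfl) x)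
        (inflH1 (twist χ (ad0 r)) (twist (χ.comp π.toMonoidHom) (ad0 (r.comp π.toMonoidHom))) π
          (fun _ => rfl) y) =
      inflH2 (charRep χ) (charRep (χ.comp π.toMonoidHom)) π (fun _ => rfl)
        (tracePairing r hr χ hχ x y) := by
  obtain ⟨c, rfl⟩ := Submodule.mkQ_surjective _ x
  obtain ⟨d, rfl⟩ := Submodule.mkQ_surjective _ y
  rfl

end TameDuality

open TameDuality
theorem mainTheorem10
    (F : Type*) [Field F] [Finite F] (ℓ : ℕ) [Fact ℓ.Prime] [CharP F ℓ]
    (p j q : ℕ) (hp : p.Prime) (hj : 0 < j) (hq : q = p ^ j) (hℓq : ℓ.Coprime q) :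
    ∃ e : H2 (charRep (cyclotomic F ℓ q hℓq)) ≃ₗ[F] F,
      -- every class has a normalized representative, on which `e` is given by the formula
      (∀ x : H2 (charRep (cyclotomic F ℓ q hℓq)),
        ∃ c : Z2 (charRep (cyclotomic F ℓ q hℓq)), IsNormalized c.1 ∧ cls2 c = x) ∧
      (∀ c : Z2 (charRep (cyclotomic F ℓ q hℓq)), IsNormalized c.1 →
        e (cls2 c) = ∑ i ∈ Finset.Icc 1 (q ^ (ℓ - 1) - 1), c.1 (tameT q ^ i, tameT q)
          + c.1 (tameT q ^ q ^ (ℓ - 1), tameS q ^ (ℓ - 1))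
          - c.1 (tameS q ^ (ℓ - 1), tameT q)) ∧
      -- the trace pairing on 1-cocycles of the tame group
      (∀ (n : ℕ) (r : TameGroup q →* GL (Fin n) F) (hr : IsLocallyConstant r),
        r (tameT q) = 1 →
        ∀ (c₁ : Z1 (ad0 r)) (c₂ : Z1 (twist (cyclotomic F ℓ q hℓq) (ad0 r))),
          (¬ (ℓ = 2 ∧ q ≡ 3 [MOD 4]) →
            e (tracePairing r hr (cyclotomic F ℓ q hℓq)
                (cyclotomic_locallyConstant F ℓ q hℓq) (cls1 c₁) (cls1 c₂)) =
              Matrix.trace ((c₁.1 (tameS q)).1 * (c₂.1 (tameT q)).1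
                - (c₂.1 (tameS q)).1 * (c₁.1 (tameT q)).1)) ∧
          (ℓ = 2 ∧ q ≡ 3 [MOD 4] →
            e (tracePairing r hr (cyclotomic F ℓ q hℓq)
                (cyclotomic_locallyConstant F ℓ q hℓq) (cls1 c₁) (cls1 c₂)) =
              Matrix.trace ((c₁.1 (tameS q)).1 * (c₂.1 (tameT q)).1
                + (c₂.1 (tameS q)).1 * (c₁.1 (tameT q)).1
                + (c₁.1 (tameT q)).1 * (c₂.1 (tameT q)).1))) ∧
      -- the same pairing for a profinite group `G` with tame quotient `TameGroup q`
      ∀ (G : Type*) [Group G] [TopologicalSpace G] [IsTopologicalGroup G] [CompactSpace G]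
        [T2Space G] [TotallyDisconnectedSpace G] (π : G →ₜ* TameGroup q),
        Function.Surjective π → IsProP p π.toMonoidHom.ker →
        ∃ eG : H2 (charRep ((cyclotomic F ℓ q hℓq).comp π.toMonoidHom)) ≃ₗ[F] F,
          (∀ x : H2 (charRep (cyclotomic F ℓ q hℓq)),
            eG (inflH2 (charRep (cyclotomic F ℓ q hℓq))
              (charRep ((cyclotomic F ℓ q hℓq).comp π.toMonoidHom)) π (fun _ => rfl) x) = e x) ∧
          ∀ (n : ℕ) (r : TameGroup q →* GL (Fin n) F) (hr : IsLocallyConstant r),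
            r (tameT q) = 1 →
            Function.Bijective
              (inflH1 (ad0 r) (ad0 (r.comp π.toMonoidHom)) π (fun _ => rfl)) ∧
            Function.Bijective
              (inflH1 (twist (cyclotomic F ℓ q hℓq) (ad0 r))
                (twist ((cyclotomic F ℓ q hℓq).comp π.toMonoidHom) (ad0 (r.comp π.toMonoidHom)))
                π (fun _ => rfl)) ∧
            ∀ (x : H1 (ad0 r)) (y : H1 (twist (cyclotomic F ℓ q hℓq) (ad0 r))),
              eG (tracePairing (r.comp π.toMonoidHom) (hr.comp_continuous π.continuous_toFun)
                  ((cyclotomic F ℓ q hℓq).comp π.toMonoidHom)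
                  ((cyclotomic_locallyConstant F ℓ q hℓq).comp_continuous π.continuous_toFun)
                  (inflH1 (ad0 r) (ad0 (r.comp π.toMonoidHom)) π (fun _ => rfl) x)
                  (inflH1 (twist (cyclotomic F ℓ q hℓq) (ad0 r))
                    (twist ((cyclotomic F ℓ q hℓq).comp π.toMonoidHom)
                      (ad0 (r.comp π.toMonoidHom))) π (fun _ => rfl) y)) =
                e (tracePairing r hr (cyclotomic F ℓ q hℓq)
                  (cyclotomic_locallyConstant F ℓ q hℓq) x y) := by
  have hqF := cast_ne_zero_of_coprime (F := F) hℓq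
  -- `q` is invertible in `F`, hence so is its prime factor `p`; this is what the averaging needs.
  have hpF : (p : F) ≠ 0 := fun h => hqF (by rw [hq, Nat.cast_pow, h, zero_pow hj.ne'])
  have : Fact p.Prime := ⟨hp⟩
  have hχ := cyclotomic_locallyConstant F ℓ q hℓq
  refine ⟨tameEquiv F ℓ q hℓq, exists_isNormalized hχ, fun c _ => rfl,
    fun n r hr ht c₁ c₂ => ⟨fun h => ?_, fun h => ?_⟩, ?_⟩
  · rw [tameEquiv_tracePairing hℓq hr ht, cast_sum_range_eq_zero hℓq h, Matrix.trace_sub, zero_mul,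
      zero_add]
  · obtain ⟨rfl, h⟩ := h
    have h2 : (2 : F) = 0 := CharP.cast_eq_zero F 2
    rw [tameEquiv_tracePairing hℓq hr ht, cast_sum_range_eq_one h, Matrix.trace_add,
      Matrix.trace_add]
    -- In characteristic two the sign of the second mixed term is immaterial.
    linear_combination -Matrix.trace ((c₂.1 (tameS q)).1 * (c₁.1 (tameT q)).1) * h2
  · intro G _ _ _ _ _ _ π hπ hK
    have hbij : Function.Bijective (inflH2 (charRep (cyclotomic F ℓ q hℓq))
        (charRep ((cyclotomic F ℓ q hℓq).comp π.toMonoidHom)) π (fun _ => rfl)) :=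
      inflH2_bijective _ hπ hK hpF
        (isDiscreteRep_charRep (hχ.comp_continuous π.continuous_toFun))
    have heq : ∀ x, ((LinearEquiv.ofBijective _ hbij).symm.trans (tameEquiv F ℓ q hℓq))
        (inflH2 (charRep (cyclotomic F ℓ q hℓq))
          (charRep ((cyclotomic F ℓ q hℓq).comp π.toMonoidHom)) π (fun _ => rfl) x) = tameEquiv F ℓ q hℓq x := fun x =>
      congrArg _ ((LinearEquiv.ofBijective _ hbij).symm_apply_apply x)
    -- `eG` is forced: the inverse of inflation followed by `e`.
    refine ⟨(LinearEquiv.ofBijective _ hbij).symm.trans (tameEquiv F ℓ q hℓq), heq,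
      fun n r hr _ => ⟨inflH1_bijective _ hπ hK hpF, inflH1_bijective _ hπ hK hpF, fun x y => ?_⟩⟩
    rw [tracePairing_inflH1 π r hr _ hχ]
    exact heq _
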